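/- Let $1\le r<n$ and let $A\in\mathbb R^{n\times n}$ be symmetric with eigenvalues $\lambda_1\ge\dots\ge\lambda_n$, $\lambda_r>\lambda_{r+1}$, and eigendecomposition $A=V_1\Lambda_1V_1^T+V_2\Lambda_2V_2^T$, where $\Lambda_1=\mathrm{diag}(\lambda_1,\dots,\lambda_r)$, $\Lambda_2=\mathrm{diag}(\lambda_{r+1},\dots,\lambda_n)$, and $V_1\in\mathbb R^{n\times r}$, $V_2\in\mathbb R^{n\times(n-r)}$ are such that $[V_1\,|\,V_2]$ is orthogonal. For $B\in\mathbb R^{n\times n}$ write $B_{i,j}=V_i^TBV_j$ ($i,j\in\{1,2\}$). Let $\|\cdot\|_2$ be the spectral norm, $\|\cdot\|_F$ the Frobenius norm and $\|M\|_{2,\infty}$ the largest Euclidean norm of a row of $M$. Put $$\mathsf{sep}_2=\mathsf{sep}_2(\Lambda_1,\Lambda_2)=\inf\{\|Z\Lambda_1-\Lambda_2Z\|_2:\ Z\in\mathbb R^{(n-r)\times r},\ \|Z\|_2=1\},$$ $$\mathsf{gap}=\min\Big\{\mathsf{sep}_2,\ \inf\{\|Z\Lambda_1-V_2\Lambda_2V_2^TZ\|_{2,\infty}:\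 Z\in\mathbb R^{n\times r},\ \mathrm{ran}\,Z\subseteq\mathrm{ran}\,V_2,\ \|Z\|_{2,\infty}=1\}\Big\}.$$ Let $E,\widetilde E\in\mathbb R^{n\times n}$ be symmetric with $E_{1,2}=\widetilde E_{1,2}$, $E_{1,1}=\widetilde E_{1,1}$, $\|E\|_2\le\mathsf{gap}/5$ and $\|\widetilde E\|_2\le\mathsf{gap}/5$, and let $\widetilde A=A+\widetilde E$. Then there is a matrix $\widetilde Y\in\mathbb R^{n\times r}$ whose range is contained in that of $V_2$, with $$-V_2\widetilde A_{2,1}+\widetilde Y\widetilde A_{1,1}-V_2\widetilde A_{2,2}V_2^T\widetilde Y+\widetilde Y\widetilde A_{1,2}V_2^T\widetilde Y=0\quad\text{and}\quad\|\widetilde Y\|_2\le\frac{4\|E_{2,1}\|_2}{\mathsf{sep}_2}.$$ Moreover, for every such $\widetilde Y$, every $\widehat V_1\in\mathbb R^{n\times r}$ with orthonormal columns whose range is the invariant subspace of $A+E$ belonging to its $r$ algebraically largest eigenvalues, and every solution $\widetilde U$ of $\min\{\|\widehat V_1U-V_1\|_F:\ U\in\mathbb R^{r\times r}\text{ orthogonal}\}$,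 $$\begin{aligned}\|\widehat V_1\widetilde U-V_1\|_{2,\infty}\le{}&8\|V_1\|_{2,\infty}\Big(\frac{\|E_{2,1}\|_2}{\mathsf{sep}_2}\Big)^2+2\,\frac{\|V_2E_{2,1}\|_{2,\infty}}{\mathsf{gap}}+4\,\frac{\|V_2E_{2,2}V_2^T\widetilde Y\|_{2,\infty}}{\mathsf{gap}}\\&+5\,\frac{(\|E_{2,2}\|_2+\|\widetilde E_{2,2}\|_2)\,\|V_2E_{2,2}V_2^T\|_{2,\infty}\,\|E_{2,1}\|_2}{\mathsf{gap}\cdot\mathsf{sep}_2^2}+10\,\frac{\|V_2E_{2,2}V_2^T\|_{2,\infty}\,\|E_{2,1}\|_2^3}{\mathsf{gap}\cdot\mathsf{sep}_2^3}.\end{aligned}$$ -/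

import Mathlib

noncomputable section

namespace RowPerturb

open Matrix

/-- The spectral norm `‖M‖₂`: the operator norm of `M` for the Euclidean norms. -/
def norm2 {p q : ℕ} (M : Matrix (Fin p) (Fin q) ℝ) : ℝ :=
  ‖LinearMap.toContinuousLinearMap (Matrix.toEuclideanLin M)‖

/-- The two-to-infinity norm `‖M‖_{2,∞}`: the largest Euclidean norm of a row of `M`. -/
def norm2Inf {p q : ℕ} (M : Matrix (Fin p) (Fin q) ℝ) : ℝ :=
  ⨆ i : Fin p, ‖(WithLp.toLp 2 (M i) : EuclideanSpace ℝ (Fin q))‖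

/-- The Frobenius norm `‖M‖_F`. -/
def normF {p q : ℕ} (M : Matrix (Fin p) (Fin q) ℝ) : ℝ :=
  Real.sqrt (∑ i, ∑ j, M i j ^ 2)

/-- The separation `sep_N(B, C) = inf {N(Z B - C Z) : N(Z) = 1}` with respect to a norm `N`. -/
def sep {l m : ℕ} (N : Matrix (Fin m) (Fin l) ℝ → ℝ)
    (B : Matrix (Fin l) (Fin l) ℝ) (C : Matrix (Fin m) (Fin m) ℝ) : ℝ :=
  sInf {t : ℝ | ∃ Z : Matrix (Fin m) (Fin l) ℝ, N Z = 1 ∧ t = N (Z * B - C * Z)}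

/-- All columns of `Z` lie in the column space of `W`. -/
def InRan {m k l : ℕ} (W : Matrix (Fin m) (Fin k) ℝ) (Z : Matrix (Fin m) (Fin l) ℝ) : Prop :=
  ∃ X : Matrix (Fin k) (Fin l) ℝ, Z = W * X

/-- The restricted separation
`sep_{N,W}(B, C) = inf {N(Z B - C Z) : Z ∈ ran W, N(Z) = 1}`. -/
def sepOn {l m k : ℕ} (N : Matrix (Fin m) (Fin l) ℝ → ℝ) (W : Matrix (Fin m) (Fin k) ℝ)
    (B : Matrix (Fin l) (Fin l) ℝ) (C : Matrix (Fin m) (Fin m) ℝ) : ℝ :=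
  sInf {t : ℝ | ∃ Z : Matrix (Fin m) (Fin l) ℝ,
    InRan W Z ∧ N Z = 1 ∧ t = N (Z * B - C * Z)}

/-- `A = V₁ Λ₁ V₁ᵀ + V₂ Λ₂ V₂ᵀ` is an eigendecomposition of the symmetric matrix `A`, with
`Λ₁ = diag lam₁` holding the `r` algebraically largest eigenvalues in descending order,
`Λ₂ = diag lam₂` the remaining `n - r` eigenvalues in descending order, and the columns of
`[V₁ | V₂]` orthonormal. -/
structure IsEigenDecomp {n r : ℕ} (A : Matrix (Fin n) (Fin n) ℝ)
    (V₁ : Matrix (Fin n) (Fin r) ℝ) (lam₁ : Fin r → ℝ)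
    (V₂ : Matrix (Fin n) (Fin (n - r)) ℝ) (lam₂ : Fin (n - r) → ℝ) : Prop where
  orth₁ : V₁ᵀ * V₁ = 1
  orth₂ : V₂ᵀ * V₂ = 1
  orth₁₂ : V₁ᵀ * V₂ = 0
  eq : A = V₁ * diagonal lam₁ * V₁ᵀ + V₂ * diagonal lam₂ * V₂ᵀ
  desc₁ : Antitone lam₁
  desc₂ : Antitone lam₂
  le : ∀ i j, lam₂ j ≤ lam₁ i

/-- `gap = min {sep₂(Λ₁, Λ₂), sep_{(2,∞),V₂}(Λ₁, V₂ Λ₂ V₂ᵀ)}`. -/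
def gap {n r : ℕ} (lam₁ : Fin r → ℝ) (V₂ : Matrix (Fin n) (Fin (n - r)) ℝ)
    (lam₂ : Fin (n - r) → ℝ) : ℝ :=
  min (sep norm2 (diagonal lam₁) (diagonal lam₂))
    (sepOn norm2Inf V₂ (diagonal lam₁) (V₂ * diagonal lam₂ * V₂ᵀ))

/-- The block `B_{i,j} = Vᵢᵀ B Vⱼ`. -/
def blk {n p q : ℕ} (Vi : Matrix (Fin n) (Fin p) ℝ) (B : Matrix (Fin n) (Fin n) ℝ)
    (Vj : Matrix (Fin n) (Fin q) ℝ) : Matrix (Fin p) (Fin q) ℝ :=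
  Viᵀ * B * Vj

/-- `W` has orthonormal columns and its range is an `r`-dimensional dominant invariant subspace
of the symmetric matrix `B`: one spanned by orthonormal eigenvectors for the `r` algebraically
largest eigenvalues of `B` (counted with multiplicity). -/
def IsDominantBasis {n r : ℕ} (B : Matrix (Fin n) (Fin n) ℝ)
    (W : Matrix (Fin n) (Fin r) ℝ) : Prop :=
  Wᵀ * W = 1 ∧
  ∃ (P₁ : Matrix (Fin n) (Fin r) ℝ) (mu₁ : Fin r → ℝ)
    (P₂ : Matrix (Fin n) (Fin (n - r)) ℝ) (mu₂ : Fin (n - r) → ℝ),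
    IsEigenDecomp B P₁ mu₁ P₂ mu₂ ∧
    LinearMap.range W.mulVecLin = LinearMap.range P₁.mulVecLin

/-- `U` solves the orthogonal Procrustes problem `min {‖W Q - V‖_F : Q orthogonal}`. -/
def IsProcrustes {n r : ℕ} (W V : Matrix (Fin n) (Fin r) ℝ)
    (U : Matrix (Fin r) (Fin r) ℝ) : Prop :=
  U ∈ Matrix.orthogonalGroup (Fin r) ℝ ∧
  ∀ Q ∈ Matrix.orthogonalGroup (Fin r) ℝ, normF (W * U - V) ≤ normF (W * Q - V)

/-- The quadratic map `G(Y) = -V₂ B₂₁ + Y B₁₁ - V₂ B₂₂ V₂ᵀ Y + Y B₁₂ V₂ᵀ Y`. -/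
def quadG {n r s : ℕ} (V₁ : Matrix (Fin n) (Fin r) ℝ) (V₂ : Matrix (Fin n) (Fin s) ℝ)
    (B : Matrix (Fin n) (Fin n) ℝ) (Y : Matrix (Fin n) (Fin r) ℝ) :
    Matrix (Fin n) (Fin r) ℝ :=
  -(V₂ * blk V₂ B V₁) + Y * blk V₁ B V₁ - V₂ * blk V₂ B V₂ * V₂ᵀ * Y
    + Y * blk V₁ B V₂ * V₂ᵀ * Y

end RowPerturb

end

/-!
# Row-wise perturbation of a dominant invariant subspace

Write `d = sep₂`, which for diagonal blocks equals `λ_r - λ_{r+1}`, and `g = gap ≤ d`; all the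
perturbations have spectral norm at most `g / 5`.

*Separation.* If `M ≥ a` and `C ≤ b` as quadratic forms, then `(a - b) ‖Z‖ ≤ ‖Z M - C Z‖`: test the
right side against a top singular pair of `Z` (`sylvester_l2_opNorm_ge`). This computes `sep₂` and,
by equivalence of norms, shows `gap > 0`.

*Existence of small roots.* Let `W` be an orthonormal basis of the dominant subspace of `A + E`. By
a dimension count its `r` largest eigenvalues are at least `λ_r - ‖E‖`, so the separation bound
applied to `Z = V₂ᵀ W` gives `‖V₂ᵀ W‖ ≤ 1 / 4` (the Davis-Kahan sine theorem). Hence `V₁ᵀ W` is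
invertible and `W = (V₁ + V₂ X) (V₁ᵀ W)`, where `X` solves the Riccati equation
`X Λ₁ - Λ₂ X = E₂₁ - X E₁₁ + E₂₂ X - X E₁₂ X` and `‖X‖ ≤ 1` (`exists_riccati_of_dominant`). The
equation itself improves this to `‖X‖ ≤ 2 ‖E₂₁‖ / d` (`riccati_norm_le`). Applied to `Ẽ` this yields
the root `Ỹ = V₂ X`; no fixed-point iteration is needed.

*The row-wise bound.* The Procrustes solution `U` makes `V₁ᵀ W U` positive definite, so that
`W U = (V₁ + V₂ X) H` with `H = (1 + Xᵀ X)^(-1/2)`, and the error is controlled by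
`‖V₁‖_{2,∞} ‖X‖² + ‖V₂ X‖_{2,∞}` (`procrustes_norm2Inf_le`). The Riccati equation, read in the norm
`‖·‖_{2,∞}`, bounds `g ‖V₂ X‖_{2,∞}` by multiples of `‖V₂ E₂₁‖_{2,∞}` and `‖V₂ E₂₂ X‖_{2,∞}`
(`riccati_norm2Inf_le`). In the last term `X` is replaced by the root for `Ẽ`, at the cost of
`‖V₂ E₂₂ V₂ᵀ‖_{2,∞}` times the distance of the two roots, which is at most a multiple of
`(‖E₂₂‖ + ‖Ẽ₂₂‖) ‖E₂₁‖ / d²` (`riccati_sub_norm_le`).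
-/

noncomputable section

namespace RowPerturb

open Matrix WithLp
open scoped Matrix.Norms.L2Operator

variable {n r p q k : ℕ}

/-! ### Spectral norm and quadratic forms -/

/-- The spectral norm `norm2` is definitionally Mathlib's `L2` operator norm on matrices, which makes
the normed-space API available. -/
theorem norm2_eq_l2_opNorm (M : Matrix (Fin p) (Fin q) ℝ) : norm2 M = ‖M‖ := rfl

theorem norm_toLp_sq (v : Fin p → ℝ) : ‖toLp 2 v‖ ^ 2 = v ⬝ᵥ v := by
  rw [EuclideanSpace.norm_sq_eq]
  simp [dotProduct, sq]

theorem dotProduct_le_norm_mul (v w : Fin p → ℝ) : v ⬝ᵥ w ≤ ‖toLp 2 v‖ * ‖toLp 2 w‖ := by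
  have h := real_inner_le_norm (toLp 2 w) (toLp 2 v)
  rw [EuclideanSpace.inner_toLp_toLp] at h
  simpa [mul_comm] using h

theorem dotProduct_mulVec_le (F : Matrix (Fin p) (Fin q) ℝ) (w : Fin p → ℝ) (z : Fin q → ℝ) :
    w ⬝ᵥ F *ᵥ z ≤ ‖F‖ * ‖toLp 2 w‖ * ‖toLp 2 z‖ := by
  refine (dotProduct_le_norm_mul _ _).trans ?_
  have := l2_opNorm_mulVec F (toLp 2 z)
  calc _ ≤ ‖toLp 2 w‖ * (‖F‖ * ‖toLp 2 z‖) := by gcongr; exact this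
    _ = _ := by ring

theorem dotProduct_mulVec_self_le (F : Matrix (Fin p) (Fin p) ℝ) (z : Fin p → ℝ) :
    |z ⬝ᵥ F *ᵥ z| ≤ ‖F‖ * (z ⬝ᵥ z) := by
  have h1 := dotProduct_mulVec_le F z z
  have h2 := dotProduct_mulVec_le F (-z) z
  rw [← norm_toLp_sq, abs_le']
  simp only [toLp_neg, norm_neg, neg_dotProduct] at h2
  constructor <;> nlinarith

theorem l2_opNorm_le_of_forall {M : Matrix (Fin p) (Fin q) ℝ} {c : ℝ} (hc : 0 ≤ c)
    (h : ∀ v, ‖toLp 2 (M *ᵥ v)‖ ≤ c * ‖toLp 2 v‖) : ‖M‖ ≤ c := by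
  rw [l2_opNorm_def]
  exact ContinuousLinearMap.opNorm_le_bound _ hc fun v => h (ofLp v)

theorem l2_opNorm_transpose (M : Matrix (Fin p) (Fin q) ℝ) : ‖Mᵀ‖ = ‖M‖ := by
  rw [← conjTranspose_eq_transpose_of_trivial, l2_opNorm_conjTranspose]

theorem l2_opNorm_transpose_mul_self (M : Matrix (Fin p) (Fin q) ℝ) :
    ‖Mᵀ * M‖ = ‖M‖ * ‖M‖ := by
  rw [← conjTranspose_eq_transpose_of_trivial, l2_opNorm_conjTranspose_mul_self]

theorem l2_opNorm_one_le : ‖(1 : Matrix (Fin p) (Fin p) ℝ)‖ ≤ 1 := by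
  rw [← diagonal_one, l2_opNorm_diagonal]
  exact (pi_norm_le_iff_of_nonneg zero_le_one).2 fun i => by simp

theorem l2_opNorm_le_one_of_orthonormal {V : Matrix (Fin p) (Fin q) ℝ} (hV : Vᵀ * V = 1) :
    ‖V‖ ≤ 1 := by
  have h := l2_opNorm_transpose_mul_self V
  rw [hV] at h
  nlinarith [l2_opNorm_one_le (p := q), norm_nonneg V]

theorem l2_opNorm_mul_left_le {V : Matrix (Fin p) (Fin q) ℝ} (hV : ‖V‖ ≤ 1)
    (M : Matrix (Fin q) (Fin k) ℝ) : ‖V * M‖ ≤ ‖M‖ :=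
  (l2_opNorm_mul _ _).trans (mul_le_of_le_one_left (norm_nonneg _) hV)

theorem l2_opNorm_mul_right_le {V : Matrix (Fin q) (Fin k) ℝ} (hV : ‖V‖ ≤ 1)
    (M : Matrix (Fin p) (Fin q) ℝ) : ‖M * V‖ ≤ ‖M‖ :=
  (l2_opNorm_mul _ _).trans (mul_le_of_le_one_right (norm_nonneg _) hV)

theorem l2_opNorm_mul_of_orthonormal {V : Matrix (Fin p) (Fin q) ℝ} (hV : Vᵀ * V = 1)
    (M : Matrix (Fin q) (Fin k) ℝ) : ‖V * M‖ = ‖M‖ := by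
  have h := l2_opNorm_le_one_of_orthonormal hV
  refine le_antisymm (l2_opNorm_mul_left_le h M) ?_
  have := l2_opNorm_mul_left_le ((l2_opNorm_transpose V).trans_le h) (V * M)
  rwa [← Matrix.mul_assoc, hV, Matrix.one_mul] at this

/-! ### The two-to-infinity norm -/

theorem norm_row_le (M : Matrix (Fin p) (Fin q) ℝ) (i : Fin p) :
    ‖(toLp 2 (M i) : EuclideanSpace ℝ (Fin q))‖ ≤ norm2Inf M :=
  le_ciSup (f := fun i => ‖(toLp 2 (M i) : EuclideanSpace ℝ (Fin q))‖) (Set.finite_range _).bddAbove i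

theorem norm2Inf_nonneg (M : Matrix (Fin p) (Fin q) ℝ) : 0 ≤ norm2Inf M :=
  Real.iSup_nonneg fun _ => norm_nonneg _

theorem norm2Inf_le {M : Matrix (Fin p) (Fin q) ℝ} {c : ℝ} (hc : 0 ≤ c)
    (h : ∀ i, ‖(toLp 2 (M i) : EuclideanSpace ℝ (Fin q))‖ ≤ c) : norm2Inf M ≤ c :=
  Real.iSup_le h hc

theorem norm2Inf_add_le (M N : Matrix (Fin p) (Fin q) ℝ) :
    norm2Inf (M + N) ≤ norm2Inf M + norm2Inf N :=
  norm2Inf_le (add_nonneg (norm2Inf_nonneg M) (norm2Inf_nonneg N)) fun i =>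
    (norm_add_le (toLp 2 (M i)) (toLp 2 (N i))).trans
      (add_le_add (norm_row_le M i) (norm_row_le N i))

theorem norm2Inf_smul (c : ℝ) (M : Matrix (Fin p) (Fin q) ℝ) :
    norm2Inf (c • M) = |c| * norm2Inf M := by
  unfold norm2Inf
  rw [Real.mul_iSup_of_nonneg (abs_nonneg c)]
  congr 1
  ext i
  exact norm_smul c (toLp 2 (M i))

theorem norm2Inf_neg (M : Matrix (Fin p) (Fin q) ℝ) : norm2Inf (-M) = norm2Inf M := by
  rw [← neg_one_smul ℝ M, norm2Inf_smul]
  simp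

theorem norm2Inf_sub_le (M N : Matrix (Fin p) (Fin q) ℝ) :
    norm2Inf (M - N) ≤ norm2Inf M + norm2Inf N := by
  rw [sub_eq_add_neg, ← norm2Inf_neg N]
  exact norm2Inf_add_le M (-N)

theorem norm2Inf_mul_le (M : Matrix (Fin p) (Fin q) ℝ) (N : Matrix (Fin q) (Fin k) ℝ) :
    norm2Inf (M * N) ≤ norm2Inf M * ‖N‖ := by
  refine norm2Inf_le (mul_nonneg (norm2Inf_nonneg M) (norm_nonneg N)) fun i => ?_
  have h := l2_opNorm_mulVec Nᵀ (toLp 2 (M i))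
  rw [l2_opNorm_transpose, mulVec_transpose] at h
  calc _ ≤ ‖N‖ * ‖(toLp 2 (M i) : EuclideanSpace ℝ (Fin q))‖ := h
    _ ≤ ‖N‖ * norm2Inf M := by gcongr; exact norm_row_le M i
    _ = _ := mul_comm _ _

theorem norm2Inf_le_l2_opNorm (M : Matrix (Fin p) (Fin q) ℝ) : norm2Inf M ≤ ‖M‖ := by
  refine norm2Inf_le (norm_nonneg M) fun i => ?_
  have h := l2_opNorm_mulVec Mᵀ (toLp 2 (Pi.single i 1))
  rw [l2_opNorm_transpose, mulVec_transpose, single_one_vecMul] at h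
  calc _ ≤ ‖M‖ * ‖(toLp 2 (Pi.single i 1) : EuclideanSpace ℝ (Fin p))‖ := h
    _ = ‖M‖ := by simp

theorem l2_opNorm_le_mul_norm2Inf (M : Matrix (Fin p) (Fin q) ℝ) :
    ‖M‖ ≤ √p * norm2Inf M := by
  have h0 := norm2Inf_nonneg M
  refine l2_opNorm_le_of_forall (by positivity) fun v => ?_
  refine abs_le_of_sq_le_sq' ?_ (by positivity) |>.2
  rw [mul_pow, mul_pow, Real.sq_sqrt (by positivity), EuclideanSpace.norm_sq_eq]
  calc ∑ i, ‖(M *ᵥ v) i‖ ^ 2 ≤ ∑ _i : Fin p, (norm2Inf M * ‖toLp 2 v‖) ^ 2 := by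
        refine Finset.sum_le_sum fun i _ => ?_
        have h1 : ‖(M *ᵥ v) i‖ ≤ norm2Inf M * ‖toLp 2 v‖ := by
          have h2 := abs_real_inner_le_norm (toLp 2 v) (toLp 2 (M i))
          rw [EuclideanSpace.inner_toLp_toLp] at h2
          have h3 := mul_le_mul_of_nonneg_left (norm_row_le M i) (norm_nonneg (toLp 2 v))
          rw [Real.norm_eq_abs]
          calc _ ≤ _ := h2
            _ ≤ _ := h3
            _ = _ := mul_comm _ _
        gcongr
    _ = _ := by simp [mul_pow]; ring

/-! ### Separation of quadratic forms -/

/-- A unit vector `z` at which `‖Z z‖` is maximal, i.e. an eigenvector of `Zᵀ Z` for its largest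
eigenvalue, which is `‖Z‖²`. -/
theorem exists_top_singular_vector [NeZero q] (Z : Matrix (Fin p) (Fin q) ℝ) :
    ∃ z : Fin q → ℝ, z ⬝ᵥ z = 1 ∧ Zᵀ *ᵥ (Z *ᵥ z) = (‖Z‖ ^ 2) • z := by
  have hG : (Zᵀ * Z).IsHermitian := by
    rw [← conjTranspose_eq_transpose_of_trivial]; exact isHermitian_conjTranspose_mul_self Z
  have hnorm : ‖Zᵀ * Z‖ = ‖hG.eigenvalues‖ := by
    conv_lhs => rw [hG.spectral_theorem]
    rw [Unitary.conjStarAlgAut_apply, ← Unitary.coe_star, CStarRing.norm_mul_coe_unitary,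
      CStarRing.norm_coe_unitary_mul, l2_opNorm_diagonal]
    rfl
  obtain ⟨i, hi⟩ : ∃ i, ‖hG.eigenvalues i‖ = ‖hG.eigenvalues‖ := by
    obtain ⟨i, -, hi⟩ := Finset.exists_mem_eq_sup Finset.univ ⟨0, Finset.mem_univ _⟩
      (fun i => ‖hG.eigenvalues i‖₊)
    exact ⟨i, by rw [Pi.norm_def, hi]; rfl⟩
  have hnn : 0 ≤ hG.eigenvalues i := by
    refine Matrix.PosSemidef.eigenvalues_nonneg (A := Zᵀ * Z) ?_ i
    rw [← conjTranspose_eq_transpose_of_trivial]; exact posSemidef_conjTranspose_mul_self Z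
  refine ⟨hG.eigenvectorBasis i, ?_, ?_⟩
  · rw [← norm_toLp_sq]
    simp
  · rw [mulVec_mulVec, hG.mulVec_eigenvectorBasis]
    congr 1
    rw [← Real.norm_of_nonneg hnn, hi, ← hnorm, l2_opNorm_transpose_mul_self, sq]

/-- Lower bound for the Sylvester operator of two separated quadratic forms. With `z` a top right
singular vector of `Z`, the form `(Z z) ⬝ (Z M - C Z) z` equals `‖Z‖² (z ⬝ M z) - (Z z) ⬝ C (Z z)`. -/
theorem sylvester_l2_opNorm_ge {M : Matrix (Fin q) (Fin q) ℝ} {C : Matrix (Fin p) (Fin p) ℝ}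
    {a b : ℝ} (hM : ∀ z, a * (z ⬝ᵥ z) ≤ z ⬝ᵥ M *ᵥ z) (hC : ∀ w, w ⬝ᵥ C *ᵥ w ≤ b * (w ⬝ᵥ w))
    (Z : Matrix (Fin p) (Fin q) ℝ) : (a - b) * ‖Z‖ ≤ ‖Z * M - C * Z‖ := by
  rcases (norm_nonneg Z).eq_or_lt with h0 | h0
  · rw [← h0, mul_zero]; exact norm_nonneg _
  have : NeZero q := ⟨by
    rintro rfl
    rw [Subsingleton.elim Z 0, norm_zero] at h0
    exact h0.false⟩
  obtain ⟨z, hz, hZ⟩ := exists_top_singular_vector Z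
  have hw : (Z *ᵥ z) ⬝ᵥ (Z *ᵥ z) = ‖Z‖ ^ 2 := by
    rw [dotProduct_mulVec, ← mulVec_transpose, hZ, smul_dotProduct, hz]; simp
  have hwn : ‖toLp 2 (Z *ᵥ z)‖ = ‖Z‖ := by
    rw [← norm_toLp_sq] at hw
    exact (sq_eq_sq₀ (norm_nonneg _) (norm_nonneg _)).1 hw
  have hzn : ‖toLp 2 z‖ = 1 := by
    rw [← norm_toLp_sq] at hz
    exact (sq_eq_sq₀ (norm_nonneg _) zero_le_one).1 (by simpa using hz)
  have key : (Z *ᵥ z) ⬝ᵥ (Z * M - C * Z) *ᵥ z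
      = ‖Z‖ ^ 2 * (z ⬝ᵥ M *ᵥ z) - (Z *ᵥ z) ⬝ᵥ C *ᵥ (Z *ᵥ z) := by
    rw [sub_mulVec, dotProduct_sub, ← mulVec_mulVec, ← mulVec_mulVec, dotProduct_mulVec,
      ← mulVec_transpose, hZ, smul_dotProduct, smul_eq_mul]
  have h1 := dotProduct_mulVec_le (Z * M - C * Z) (Z *ᵥ z) z
  have h2 := mul_le_mul_of_nonneg_left (hM z) (sq_nonneg ‖Z‖)
  have h3 := hC (Z *ᵥ z)
  rw [key, hwn, hzn] at h1
  rw [hz] at h2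
  rw [hw] at h3
  refine le_of_mul_le_mul_right ?_ h0
  nlinarith

theorem l2_opNorm_single_one (j : Fin p) (i : Fin q) :
    ‖(single j i 1 : Matrix (Fin p) (Fin q) ℝ)‖ = 1 := by
  have h := l2_opNorm_transpose_mul_self (single j i 1 : Matrix (Fin p) (Fin q) ℝ)
  rw [transpose_single, single_mul_single_same, one_mul, ← diagonal_single, l2_opNorm_diagonal,
    Pi.norm_single, norm_one] at h
  nlinarith [norm_nonneg (single j i 1 : Matrix (Fin p) (Fin q) ℝ)]

theorem le_dotProduct_diagonal_mulVec {d : Fin p → ℝ} {a : ℝ} (h : ∀ i, a ≤ d i) (z : Fin p → ℝ) :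
    a * (z ⬝ᵥ z) ≤ z ⬝ᵥ diagonal d *ᵥ z := by
  simp only [dotProduct, mulVec_diagonal, Finset.mul_sum]
  refine Finset.sum_le_sum fun i _ => ?_
  nlinarith [mul_le_mul_of_nonneg_right (h i) (mul_self_nonneg (z i))]

theorem dotProduct_diagonal_mulVec_le {d : Fin p → ℝ} {b : ℝ} (h : ∀ i, d i ≤ b) (z : Fin p → ℝ) :
    z ⬝ᵥ diagonal d *ᵥ z ≤ b * (z ⬝ᵥ z) := by
  simp only [dotProduct, mulVec_diagonal, Finset.mul_sum]
  refine Finset.sum_le_sum fun i _ => ?_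
  nlinarith [mul_le_mul_of_nonneg_right (h i) (mul_self_nonneg (z i))]

/-! ### The separations and the gap -/

/-- For diagonal blocks with separated entries the spectral-norm separation is the distance of the
entries: it is attained at a matrix unit. -/
theorem sep_diagonal {lam₁ : Fin q → ℝ} {lam₂ : Fin p → ℝ} {i₀ : Fin q} {j₀ : Fin p}
    (hi : ∀ i, lam₁ i₀ ≤ lam₁ i) (hj : ∀ j, lam₂ j ≤ lam₂ j₀) (h : lam₂ j₀ ≤ lam₁ i₀) :
    sep norm2 (diagonal lam₁) (diagonal lam₂) = lam₁ i₀ - lam₂ j₀ := by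
  have hmem : lam₁ i₀ - lam₂ j₀ ∈ {t : ℝ | ∃ Z : Matrix (Fin p) (Fin q) ℝ,
      norm2 Z = 1 ∧ t = norm2 (Z * diagonal lam₁ - diagonal lam₂ * Z)} := by
    refine ⟨single j₀ i₀ 1, l2_opNorm_single_one _ _, ?_⟩
    have : (single j₀ i₀ (1 : ℝ) * diagonal lam₁ - diagonal lam₂ * single j₀ i₀ (1 : ℝ) :
        Matrix (Fin p) (Fin q) ℝ) = (lam₁ i₀ - lam₂ j₀) • single j₀ i₀ (1 : ℝ) := by
      ext a b
      simp only [Matrix.sub_apply, mul_diagonal, diagonal_mul, Matrix.smul_apply, single_apply, smul_eq_mul]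
      split_ifs with hab
      · rw [← hab.1, ← hab.2]; ring
      · simp
    rw [this, norm2_eq_l2_opNorm, norm_smul, l2_opNorm_single_one, mul_one,
      Real.norm_of_nonneg (sub_nonneg.2 h)]
  refine le_antisymm (csInf_le ⟨0, ?_⟩ hmem) (le_csInf ⟨_, hmem⟩ ?_)
  · rintro _ ⟨Z, -, rfl⟩
    exact norm_nonneg _
  · rintro _ ⟨Z, hZ, rfl⟩
    have := sylvester_l2_opNorm_ge (le_dotProduct_diagonal_mulVec hi)
      (dotProduct_diagonal_mulVec_le hj) Z
    rw [norm2_eq_l2_opNorm] at hZ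
    rwa [hZ, mul_one] at this

theorem sepOn_mul_norm2Inf_le {W : Matrix (Fin p) (Fin k) ℝ} {Z : Matrix (Fin p) (Fin q) ℝ}
    (hZ : InRan W Z) (B : Matrix (Fin q) (Fin q) ℝ) (C : Matrix (Fin p) (Fin p) ℝ) :
    sepOn norm2Inf W B C * norm2Inf Z ≤ norm2Inf (Z * B - C * Z) := by
  rcases (norm2Inf_nonneg Z).eq_or_lt with h0 | h0
  · rw [← h0, mul_zero]; exact norm2Inf_nonneg _
  obtain ⟨X, hX⟩ := hZ
  have hle : sepOn norm2Inf W B C ≤ (norm2Inf Z)⁻¹ * norm2Inf (Z * B - C * Z) := by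
    refine csInf_le ⟨0, ?_⟩ ⟨(norm2Inf Z)⁻¹ • Z, ⟨(norm2Inf Z)⁻¹ • X, ?_⟩, ?_, ?_⟩
    · rintro _ ⟨Z, -, -, rfl⟩
      exact norm2Inf_nonneg _
    · rw [Matrix.mul_smul, ← hX]
    · rw [norm2Inf_smul, abs_of_pos (inv_pos.2 h0), inv_mul_cancel₀ h0.ne']
    · rw [Matrix.smul_mul, Matrix.mul_smul, ← smul_sub, norm2Inf_smul, abs_of_pos (inv_pos.2 h0)]
  rwa [inv_mul_eq_div, le_div_iff₀ h0] at hle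

/-- The gap is positive: in the two-to-infinity norm the separation is at least that in the spectral
norm up to the factor `√n` between the two norms. -/
theorem gap_pos {lam₁ : Fin r → ℝ} {V₂ : Matrix (Fin n) (Fin (n - r)) ℝ} {lam₂ : Fin (n - r) → ℝ}
    (hV : V₂ᵀ * V₂ = 1) {i₀ : Fin r} {j₀ : Fin (n - r)}
    (hi : ∀ i, lam₁ i₀ ≤ lam₁ i) (hj : ∀ j, lam₂ j ≤ lam₂ j₀) (h : lam₂ j₀ < lam₁ i₀) :
    0 < gap lam₁ V₂ lam₂ := by
  have hd : 0 < lam₁ i₀ - lam₂ j₀ := sub_pos.2 h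
  refine lt_min (by rwa [sep_diagonal hi hj h.le]) ?_
  have hn : (0 : ℝ) < √n := Real.sqrt_pos.2 (by have := j₀.2; exact_mod_cast (by omega : 0 < n))
  refine (div_pos hd hn).trans_le (le_csInf ?_ ?_)
  · set S : Matrix (Fin (n - r)) (Fin r) ℝ := single j₀ i₀ 1
    have hZ : 0 < norm2Inf (V₂ * S) := by
      have h1 := l2_opNorm_le_mul_norm2Inf (V₂ * S)
      rw [l2_opNorm_mul_of_orthonormal hV, l2_opNorm_single_one] at h1
      exact pos_of_mul_pos_right (zero_lt_one.trans_le h1) hn.le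
    refine ⟨_, (norm2Inf (V₂ * S))⁻¹ • (V₂ * S), ⟨(norm2Inf (V₂ * S))⁻¹ • S, ?_⟩, ?_, rfl⟩
    · rw [Matrix.mul_smul]
    · rw [norm2Inf_smul, abs_of_pos (inv_pos.2 hZ), inv_mul_cancel₀ hZ.ne']
  · rintro _ ⟨_, ⟨X, rfl⟩, hX, rfl⟩
    have hfac : V₂ * X * diagonal lam₁ - V₂ * diagonal lam₂ * V₂ᵀ * (V₂ * X)
        = V₂ * (X * diagonal lam₁ - diagonal lam₂ * X) := by
      rw [Matrix.mul_sub, Matrix.mul_assoc (V₂ * diagonal lam₂), ← Matrix.mul_assoc V₂ᵀ, hV,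
        Matrix.one_mul]
      simp only [Matrix.mul_assoc]
    rw [div_le_iff₀ hn, mul_comm, hfac]
    have h1 := l2_opNorm_le_mul_norm2Inf (V₂ * (X * diagonal lam₁ - diagonal lam₂ * X))
    rw [l2_opNorm_mul_of_orthonormal hV] at h1
    have h2 := sylvester_l2_opNorm_ge (le_dotProduct_diagonal_mulVec hi)
      (dotProduct_diagonal_mulVec_le hj) X
    have h3 := norm2Inf_le_l2_opNorm (V₂ * X)
    rw [hX, l2_opNorm_mul_of_orthonormal hV] at h3
    rw [mul_comm]
    nlinarith

/-! ### The orthogonal Procrustes problem -/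

theorem normF_sq (M : Matrix (Fin p) (Fin q) ℝ) : normF M ^ 2 = trace (Mᵀ * M) := by
  have h0 : 0 ≤ ∑ i, ∑ j, M i j ^ 2 := by positivity
  rw [normF, Real.sq_sqrt h0, Finset.sum_comm]
  simp [trace, mul_apply, sq]

open scoped MatrixOrder in
theorem exists_posDef_mul_self_eq {P : Matrix (Fin p) (Fin p) ℝ} (hP : P.PosDef) :
    ∃ H : Matrix (Fin p) (Fin p) ℝ, H.PosDef ∧ H * H = P := by
  have h0 : 0 ≤ P := nonneg_iff_posSemidef.2 hP.posSemidef
  have hH : CFC.sqrt P * CFC.sqrt P = P := CFC.sqrt_mul_sqrt_self P h0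
  refine ⟨CFC.sqrt P, ?_, hH⟩
  rw [(nonneg_iff_posSemidef.1 (CFC.sqrt_nonneg P)).posDef_iff_isUnit]
  have := hP.isUnit
  rw [← hH] at this
  exact isUnit_of_mul_isUnit_left this

/-- If the identity maximizes `trace (K Q)` over orthogonal `Q`, then the polar decomposition
`K = H Q` of the invertible matrix `K` has `Q = 1`: maximality at `Qᵀ` forces
`trace ((1 - Q)ᵀ H (1 - Q)) ≤ 0`. -/
theorem posDef_of_trace_mul_orthogonal_le {K : Matrix (Fin p) (Fin p) ℝ} (hK : IsUnit K)
    (h : ∀ Q : Matrix (Fin p) (Fin p) ℝ, Q * Qᵀ = 1 → trace (K * Q) ≤ trace K) : K.PosDef := by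
  obtain ⟨H, hH, hHK⟩ := exists_posDef_mul_self_eq (P := K * Kᵀ) (by
    have h1 : (K * Kᵀ).PosSemidef := by
      rw [← conjTranspose_eq_transpose_of_trivial]; exact posSemidef_self_mul_conjTranspose K
    refine h1.posDef_iff_isUnit.2 (hK.mul ?_)
    exact (isUnit_transpose K).2 hK)
  have hHu : IsUnit H.det := (isUnit_iff_isUnit_det _).1 hH.isUnit
  have hHs : Hᵀ = H := by
    have := hH.isHermitian.eq
    rwa [conjTranspose_eq_transpose_of_trivial] at this
  obtain ⟨Q, hQ⟩ : ∃ Q, Q = H⁻¹ * K := ⟨_, rfl⟩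
  have hKQ : K = H * Q := by rw [hQ, mul_nonsing_inv_cancel_left _ _ hHu]
  have hQQ : Q * Qᵀ = 1 := by
    rw [hQ, transpose_mul, transpose_nonsing_inv, hHs, Matrix.mul_assoc, ← Matrix.mul_assoc K,
      ← hHK, Matrix.mul_assoc H, mul_nonsing_inv _ hHu, Matrix.mul_one, nonsing_inv_mul _ hHu]
  have hQQ' : Qᵀ * Q = 1 := mul_eq_one_comm.1 hQQ
  have h1 := h Qᵀ (by rw [transpose_transpose, hQQ'])
  rw [hKQ, Matrix.mul_assoc, hQQ, Matrix.mul_one] at h1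
  have htr : trace (H * Qᵀ) = trace (H * Q) := by
    rw [← trace_transpose, transpose_mul, transpose_transpose, hHs, trace_mul_comm]
  have hexp : trace ((1 - Q)ᴴ * H * (1 - Q)) = 2 * (trace H - trace (H * Q)) := by
    rw [conjTranspose_eq_transpose_of_trivial, Matrix.mul_assoc, trace_mul_comm, Matrix.mul_assoc,
      transpose_sub, transpose_one]
    simp only [Matrix.mul_sub, Matrix.sub_mul, Matrix.mul_one, Matrix.one_mul, hQQ, trace_sub, htr]
    ring
  have hps : ((1 - Q)ᴴ * H * (1 - Q)).PosSemidef := hH.posSemidef.conjTranspose_mul_mul_same _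
  have hzero : (1 - Q)ᴴ * H * (1 - Q) = 0 :=
    hps.trace_eq_zero_iff.1 (le_antisymm (by linarith) hps.trace_nonneg)
  have h1Q : 1 - Q = 0 := by
    ext i j
    have hx := congrFun (congrFun hzero j) j
    by_contra hne
    have hcol : (1 - Q) *ᵥ Pi.single j 1 ≠ 0 := fun h0 => hne (by
      simpa using congrFun h0 i)
    have := hH.dotProduct_mulVec_pos hcol
    refine this.ne' ?_
    rw [star_mulVec, ← dotProduct_mulVec, mulVec_mulVec, mulVec_mulVec, hzero]
    simp
  rw [hKQ, ← sub_eq_zero.1 h1Q, Matrix.mul_one]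
  exact hH

theorem IsProcrustes.posDef {W V : Matrix (Fin n) (Fin r) ℝ} {U : Matrix (Fin r) (Fin r) ℝ}
    (hU : IsProcrustes W V U) (hW : Wᵀ * W = 1) (hu : IsUnit (Vᵀ * W)) : (Vᵀ * W * U).PosDef := by
  have key : ∀ Q ∈ orthogonalGroup (Fin r) ℝ,
      normF (W * Q - V) ^ 2 = trace (1 : Matrix (Fin r) (Fin r) ℝ) + trace (Vᵀ * V)
        - 2 * trace (Vᵀ * W * Q) := by
    intro Q hQ
    have hQ' : Qᵀ * Q = 1 := (mem_orthogonalGroup_iff' (Fin r) ℝ).1 hQ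
    have h1 : (W * Q)ᵀ * (W * Q) = 1 := by
      rw [transpose_mul, Matrix.mul_assoc, ← Matrix.mul_assoc Wᵀ, hW, Matrix.one_mul, hQ']
    have h2 : trace ((W * Q)ᵀ * V) = trace (Vᵀ * W * Q) := by
      rw [← trace_transpose, transpose_mul, transpose_transpose, Matrix.mul_assoc]
    rw [normF_sq, transpose_sub, Matrix.sub_mul, Matrix.mul_sub, Matrix.mul_sub, h1]
    simp only [trace_sub, h2, ← Matrix.mul_assoc]
    ring
  have hUU : U * Uᵀ = 1 := (mem_orthogonalGroup_iff (Fin r) ℝ).1 hU.1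
  refine posDef_of_trace_mul_orthogonal_le (hu.mul (.of_mul_eq_one _ hUU)) fun Q hQ => ?_
  have hUQ : U * Q ∈ orthogonalGroup (Fin r) ℝ :=
    mul_mem hU.1 ((mem_orthogonalGroup_iff (Fin r) ℝ).2 hQ)
  have h1 : normF (W * U - V) ^ 2 ≤ normF (W * (U * Q) - V) ^ 2 :=
    pow_le_pow_left₀ (Real.sqrt_nonneg _) (hU.2 _ hUQ) 2
  have h2 := key _ hU.1
  have h3 := key _ hUQ
  rw [Matrix.mul_assoc _ U Q]
  linarith

/-! ### Eigendecompositions and dominant subspaces -/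

theorem mulVec_dotProduct_eq (M : Matrix (Fin p) (Fin q) ℝ) (z : Fin q → ℝ) (w : Fin p → ℝ) :
    (M *ᵥ z) ⬝ᵥ w = z ⬝ᵥ Mᵀ *ᵥ w := by
  rw [dotProduct_mulVec, vecMul_transpose]

theorem mulVec_dotProduct_mulVec_of_orthonormal {V : Matrix (Fin p) (Fin q) ℝ} (hV : Vᵀ * V = 1)
    (z : Fin q → ℝ) : (V *ᵥ z) ⬝ᵥ (V *ᵥ z) = z ⬝ᵥ z := by
  rw [mulVec_dotProduct_eq, mulVec_mulVec, hV, one_mulVec]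

namespace IsEigenDecomp

variable {A : Matrix (Fin n) (Fin n) ℝ} {V₁ : Matrix (Fin n) (Fin r) ℝ} {lam₁ : Fin r → ℝ}
  {V₂ : Matrix (Fin n) (Fin (n - r)) ℝ} {lam₂ : Fin (n - r) → ℝ}

theorem orth₂₁ (h : IsEigenDecomp A V₁ lam₁ V₂ lam₂) : V₂ᵀ * V₁ = 0 := by
  have := congrArg transpose h.orth₁₂
  rwa [transpose_mul, transpose_transpose, transpose_zero] at this

theorem isSymm (h : IsEigenDecomp A V₁ lam₁ V₂ lam₂) : A.IsSymm := by
  rw [IsSymm, h.eq]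
  simp only [transpose_add, transpose_mul, transpose_transpose, diagonal_transpose,
    Matrix.mul_assoc]

theorem mul_transpose_add (h : IsEigenDecomp A V₁ lam₁ V₂ lam₂) (hr : r ≤ n) :
    V₁ * V₁ᵀ + V₂ * V₂ᵀ = 1 := by
  have h1 : fromRows V₁ᵀ V₂ᵀ * fromCols V₁ V₂ = 1 := by
    rw [fromRows_mul_fromCols, h.orth₁, h.orth₂, h.orth₁₂, h.orth₂₁, fromBlocks_one]
  rw [← fromCols_mul_fromRows]
  refine (mul_eq_one_comm_of_card_eq (Fin r ⊕ Fin (n - r)) (Fin n) ℝ ?_).1 h1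
  rw [Fintype.card_sum, Fintype.card_fin, Fintype.card_fin, Fintype.card_fin]
  omega

theorem blk₁₁ (h : IsEigenDecomp A V₁ lam₁ V₂ lam₂) : blk V₁ A V₁ = diagonal lam₁ := by
  rw [blk, h.eq]
  simp only [Matrix.mul_add, Matrix.add_mul, ← Matrix.mul_assoc, h.orth₁, h.orth₁₂]
  simp only [Matrix.mul_assoc, h.orth₁, h.orth₂₁]
  simp

theorem blk₂₂ (h : IsEigenDecomp A V₁ lam₁ V₂ lam₂) : blk V₂ A V₂ = diagonal lam₂ := by
  rw [blk, h.eq]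
  simp only [Matrix.mul_add, Matrix.add_mul, ← Matrix.mul_assoc, h.orth₂₁, h.orth₂]
  simp only [Matrix.mul_assoc, h.orth₂, h.orth₁₂]
  simp

theorem blk₁₂ (h : IsEigenDecomp A V₁ lam₁ V₂ lam₂) : blk V₁ A V₂ = 0 := by
  rw [blk, h.eq]
  simp only [Matrix.mul_add, Matrix.add_mul, ← Matrix.mul_assoc, h.orth₁, h.orth₁₂]
  simp only [Matrix.mul_assoc, h.orth₂, h.orth₁₂]
  simp

theorem blk₂₁ (h : IsEigenDecomp A V₁ lam₁ V₂ lam₂) : blk V₂ A V₁ = 0 := by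
  rw [blk, h.eq]
  simp only [Matrix.mul_add, Matrix.add_mul, ← Matrix.mul_assoc, h.orth₂₁, h.orth₂]
  simp only [Matrix.mul_assoc, h.orth₁, h.orth₂₁]
  simp

theorem transpose_mul_eq (h : IsEigenDecomp A V₁ lam₁ V₂ lam₂) :
    V₂ᵀ * A = diagonal lam₂ * V₂ᵀ := by
  rw [h.eq]
  simp only [Matrix.mul_add, ← Matrix.mul_assoc, h.orth₂₁, h.orth₂]
  simp

/-- The relevant half of the Courant-Fischer principle: a lower bound for the quadratic form of `A` on
an `r`-dimensional subspace is a lower bound for the `r` largest eigenvalues of `A`. -/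
theorem le_of_le_form (h : IsEigenDecomp A V₁ lam₁ V₂ lam₂) (hr : r ≤ n)
    {V : Matrix (Fin n) (Fin r) ℝ} (hV : Vᵀ * V = 1) {a : ℝ}
    (ha : ∀ z, a * (z ⬝ᵥ z) ≤ (V *ᵥ z) ⬝ᵥ A *ᵥ (V *ᵥ z)) (i₀ : Fin r) : a ≤ lam₁ i₀ := by
  -- a vector of the subspace orthogonal to every dominant eigenvector except the one for `lam₁ i₀`
  obtain ⟨z, hz, hNz⟩ : ∃ z ≠ 0, updateRow (V₁ᵀ * V) i₀ 0 *ᵥ z = 0 := by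
    refine exists_mulVec_eq_zero_iff.2 (det_eq_zero_of_row_eq_zero i₀ fun j => ?_)
    rw [updateRow_self]; rfl
  obtain ⟨v, hv⟩ : ∃ v, v = V *ᵥ z := ⟨_, rfl⟩
  have hx : ∀ i ≠ i₀, (V₁ᵀ *ᵥ v) i = 0 := by
    intro i hi
    have := congrFun hNz i
    rw [mulVec, updateRow_ne hi] at this
    rw [hv, mulVec_mulVec]
    exact this
  have hform : v ⬝ᵥ A *ᵥ v = (V₁ᵀ *ᵥ v) ⬝ᵥ diagonal lam₁ *ᵥ (V₁ᵀ *ᵥ v)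
      + (V₂ᵀ *ᵥ v) ⬝ᵥ diagonal lam₂ *ᵥ (V₂ᵀ *ᵥ v) := by
    rw [h.eq, add_mulVec, dotProduct_add, mulVec_dotProduct_eq V₁ᵀ, mulVec_dotProduct_eq V₂ᵀ]
    simp only [transpose_transpose, mulVec_mulVec, Matrix.mul_assoc]
  have hvv : v ⬝ᵥ v = (V₁ᵀ *ᵥ v) ⬝ᵥ (V₁ᵀ *ᵥ v) + (V₂ᵀ *ᵥ v) ⬝ᵥ (V₂ᵀ *ᵥ v) := by
    rw [mulVec_dotProduct_eq V₁ᵀ, mulVec_dotProduct_eq V₂ᵀ, ← dotProduct_add]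
    simp only [transpose_transpose, mulVec_mulVec]
    rw [← add_mulVec, h.mul_transpose_add hr, one_mulVec]
  have h1 : (V₁ᵀ *ᵥ v) ⬝ᵥ diagonal lam₁ *ᵥ (V₁ᵀ *ᵥ v)
      ≤ lam₁ i₀ * ((V₁ᵀ *ᵥ v) ⬝ᵥ (V₁ᵀ *ᵥ v)) := by
    simp only [dotProduct, mulVec_diagonal, Finset.mul_sum]
    refine Finset.sum_le_sum fun i _ => ?_
    by_cases hi : i = i₀
    · subst hi; exact le_of_eq (by ring)
    · simp [hx i hi]
  have h2 := dotProduct_diagonal_mulVec_le (fun j => h.le i₀ j) (V₂ᵀ *ᵥ v)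
  have h3 := ha z
  rw [← mulVec_dotProduct_mulVec_of_orthonormal hV, ← hv, hform] at h3
  have hpos : 0 < v ⬝ᵥ v := by
    rw [hv, mulVec_dotProduct_mulVec_of_orthonormal hV]
    exact lt_of_le_of_ne (by rw [← norm_toLp_sq]; positivity)
      (fun h0 => hz (dotProduct_self_eq_zero.1 h0.symm))
  refine le_of_mul_le_mul_right ?_ hpos
  calc a * (v ⬝ᵥ v) ≤ _ := h3
    _ ≤ _ := add_le_add h1 h2
    _ = lam₁ i₀ * (v ⬝ᵥ v) := by rw [hvv]; ring

end IsEigenDecomp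

theorem blk_add (Vi : Matrix (Fin n) (Fin p) ℝ) (A E : Matrix (Fin n) (Fin n) ℝ)
    (Vj : Matrix (Fin n) (Fin q) ℝ) : blk Vi (A + E) Vj = blk Vi A Vj + blk Vi E Vj := by
  rw [blk, Matrix.mul_add, Matrix.add_mul]; rfl

theorem transpose_blk (Vi : Matrix (Fin n) (Fin p) ℝ) {E : Matrix (Fin n) (Fin n) ℝ}
    (hE : E.IsSymm) (Vj : Matrix (Fin n) (Fin q) ℝ) : (blk Vi E Vj)ᵀ = blk Vj E Vi := by
  rw [blk, blk, transpose_mul, transpose_mul, transpose_transpose, hE.eq, Matrix.mul_assoc]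

theorem l2_opNorm_blk_le {Vi : Matrix (Fin n) (Fin p) ℝ} (hi : Viᵀ * Vi = 1)
    (E : Matrix (Fin n) (Fin n) ℝ) {Vj : Matrix (Fin n) (Fin q) ℝ} (hj : Vjᵀ * Vj = 1) :
    ‖blk Vi E Vj‖ ≤ ‖E‖ :=
  (l2_opNorm_mul_right_le (l2_opNorm_le_one_of_orthonormal hj) _).trans
    (l2_opNorm_mul_left_le
      ((l2_opNorm_transpose Vi).trans_le (l2_opNorm_le_one_of_orthonormal hi)) _)

/-- A dominant basis spans an invariant subspace, and the matrix of the restriction of `B` to it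
inherits any lower bound that the form of `B` has on some `r`-dimensional subspace. -/
theorem IsDominantBasis.exists_mul_eq {B : Matrix (Fin n) (Fin n) ℝ}
    {W : Matrix (Fin n) (Fin r) ℝ} (h : IsDominantBasis B W) (hr : r ≤ n)
    {V : Matrix (Fin n) (Fin r) ℝ} (hV : Vᵀ * V = 1) {a : ℝ}
    (ha : ∀ z, a * (z ⬝ᵥ z) ≤ (V *ᵥ z) ⬝ᵥ B *ᵥ (V *ᵥ z)) :
    ∃ M : Matrix (Fin r) (Fin r) ℝ, B * W = W * M ∧ ∀ z, a * (z ⬝ᵥ z) ≤ z ⬝ᵥ M *ᵥ z := by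
  obtain ⟨hW, P, mu, P', mu', hP, hran⟩ := h
  have hPW : P * (Pᵀ * W) = W := by
    ext i j
    obtain ⟨y, hy⟩ : W *ᵥ Pi.single j 1 ∈ LinearMap.range P.mulVecLin :=
      hran ▸ ⟨Pi.single j 1, rfl⟩
    have h1 : (P * (Pᵀ * W)) *ᵥ Pi.single j 1 = W *ᵥ Pi.single j 1 := by
      rw [← mulVec_mulVec, ← mulVec_mulVec, ← hy, mulVecLin_apply, mulVec_mulVec _ Pᵀ,
        hP.orth₁, one_mulVec]
    simpa using congrFun h1 i
  obtain ⟨Q, hQ⟩ : ∃ Q, Q = Pᵀ * W := ⟨_, rfl⟩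
  rw [← hQ] at hPW
  have hQQ : Qᵀ * Q = 1 := by
    have h1 : Wᵀ * W = Qᵀ * Q := by
      rw [← hPW, transpose_mul, Matrix.mul_assoc, ← Matrix.mul_assoc Pᵀ, hP.orth₁, Matrix.one_mul]
    rw [← h1, hW]
  have hBP : B * P = P * diagonal mu := by
    rw [hP.eq, Matrix.add_mul, Matrix.mul_assoc, hP.orth₁, Matrix.mul_assoc _ P'ᵀ, hP.orth₂₁]
    simp
  refine ⟨Qᵀ * diagonal mu * Q, ?_, fun z => ?_⟩
  · rw [← hPW, ← Matrix.mul_assoc, hBP, Matrix.mul_assoc P Q, ← Matrix.mul_assoc Q,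
      ← Matrix.mul_assoc Q, mul_eq_one_comm.1 hQQ, Matrix.one_mul, Matrix.mul_assoc]
  · have h1 := le_dotProduct_diagonal_mulVec (hP.le_of_le_form hr hV ha) (Q *ᵥ z)
    rw [mulVec_dotProduct_mulVec_of_orthonormal hQQ, mulVec_dotProduct_eq] at h1
    simpa only [mulVec_mulVec, Matrix.mul_assoc] using h1

theorem exists_isDominantBasis {B : Matrix (Fin n) (Fin n) ℝ} (hB : B.IsSymm) (hr : r ≤ n) :
    ∃ W : Matrix (Fin n) (Fin r) ℝ, IsDominantBasis B W := by
  have hH : B.IsHermitian := by rwa [IsHermitian, conjTranspose_eq_transpose_of_trivial]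
  let σ : Fin n ≃ Fin n :=
    (finCongr (Fintype.card_fin n).symm).trans (Fintype.equivOfCardEq (Fintype.card_fin _))
  let e : Fin r ⊕ Fin (n - r) ≃ Fin n := finSumFinEquiv.trans (finCongr (by omega))
  let N : Matrix (Fin n) (Fin r ⊕ Fin (n - r)) ℝ :=
    (hH.eigenvectorUnitary : Matrix (Fin n) (Fin n) ℝ).submatrix id (e.trans σ)
  let mu : Fin r ⊕ Fin (n - r) → ℝ := hH.eigenvalues ∘ (e.trans σ)
  have hanti : ∀ a b, e a ≤ e b → mu b ≤ mu a := by
    intro a b hab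
    have key : ∀ c, mu c = hH.eigenvalues₀ (finCongr (Fintype.card_fin n).symm (e c)) := by
      intro c
      simp [mu, IsHermitian.eigenvalues, σ]
    rw [key, key]
    exact hH.eigenvalues₀_antitone hab
  have hUU : (hH.eigenvectorUnitary : Matrix (Fin n) (Fin n) ℝ)ᵀ
      * (hH.eigenvectorUnitary : Matrix (Fin n) (Fin n) ℝ) = 1 := by
    have := Unitary.coe_star_mul_self hH.eigenvectorUnitary
    rwa [star_eq_conjTranspose, conjTranspose_eq_transpose_of_trivial] at this
  have hN : Nᵀ * N = 1 := by
    rw [transpose_submatrix, ← submatrix_mul _ _ _ _ _ Function.bijective_id, hUU,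
      submatrix_one_equiv]
  have hBN : B = N * diagonal mu * Nᵀ := by
    have hs := hH.spectral_theorem
    rw [Unitary.conjStarAlgAut_apply, star_eq_conjTranspose,
      conjTranspose_eq_transpose_of_trivial] at hs
    have hd : diagonal mu = (diagonal hH.eigenvalues).submatrix (e.trans σ) (e.trans σ) :=
      (submatrix_diagonal_equiv _ _).symm
    rw [hd, transpose_submatrix, submatrix_mul_equiv, submatrix_mul_equiv, submatrix_id_id]
    exact hs
  have hNc : fromCols N.toCols₁ N.toCols₂ = N := fromCols_toCols N
  have hmu : diagonal mu = fromBlocks (diagonal (mu ∘ Sum.inl)) 0 0 (diagonal (mu ∘ Sum.inr)) := by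
    rw [fromBlocks_diagonal]
    congr 1
    ext (i | i) <;> rfl
  rw [← hNc, transpose_fromCols, fromRows_mul_fromCols, ← fromBlocks_one, fromBlocks_inj] at hN
  rw [← hNc, transpose_fromCols, hmu, fromCols_mul_fromBlocks, fromCols_mul_fromRows] at hBN
  simp only [Matrix.mul_zero, add_zero, zero_add] at hBN
  refine ⟨N.toCols₁, hN.1, N.toCols₁, mu ∘ Sum.inl, N.toCols₂, mu ∘ Sum.inr,
    ⟨hN.1, hN.2.2.2, hN.2.1, hBN, fun i j hij => hanti _ _ ?_, fun i j hij => hanti _ _ ?_,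
      fun i j => hanti _ _ ?_⟩, rfl⟩
  · exact hij
  · simp only [e, Equiv.trans_apply, finSumFinEquiv_apply_right,
      Fin.le_def, finCongr_apply, Fin.val_cast, Fin.val_natAdd]
    exact Nat.add_le_add_left hij r
  · simp only [e, Equiv.trans_apply, finSumFinEquiv_apply_left, finSumFinEquiv_apply_right,
      Fin.le_def, finCongr_apply, Fin.val_cast, Fin.val_castAdd, Fin.val_natAdd]
    omega

/-! ### The Riccati equation -/

/-- At a matrix with range in that of `V₂`, the map `quadG` is the residual of the Riccati equation in
the coordinates of `V₂`. -/
theorem quadG_mul_eq {A : Matrix (Fin n) (Fin n) ℝ} {V₁ : Matrix (Fin n) (Fin r) ℝ}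
    {lam₁ : Fin r → ℝ} {V₂ : Matrix (Fin n) (Fin (n - r)) ℝ} {lam₂ : Fin (n - r) → ℝ}
    (hA : IsEigenDecomp A V₁ lam₁ V₂ lam₂) (E : Matrix (Fin n) (Fin n) ℝ)
    (X : Matrix (Fin (n - r)) (Fin r) ℝ) :
    quadG V₁ V₂ (A + E) (V₂ * X) = V₂ * ((X * diagonal lam₁ - diagonal lam₂ * X)
      - (blk V₂ E V₁ - X * blk V₁ E V₁ + blk V₂ E V₂ * X - X * blk V₁ E V₂ * X)) := by
  have h1 : ∀ M : Matrix (Fin n) (Fin (n - r)) ℝ, M * V₂ᵀ * (V₂ * X) = M * X := fun M => by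
    rw [Matrix.mul_assoc, ← Matrix.mul_assoc V₂ᵀ, hA.orth₂, Matrix.one_mul]
  rw [quadG, h1, h1]
  simp only [blk_add, hA.blk₁₁, hA.blk₁₂, hA.blk₂₁, hA.blk₂₂, Matrix.mul_add, Matrix.add_mul,
    Matrix.mul_sub, Matrix.mul_assoc, zero_add]
  abel

theorem eq_zero_of_orthonormal_mul_eq_zero {V : Matrix (Fin p) (Fin q) ℝ} (hV : Vᵀ * V = 1)
    {M : Matrix (Fin q) (Fin k) ℝ} (h : V * M = 0) : M = 0 := by
  rw [← Matrix.one_mul M, ← hV, Matrix.mul_assoc, h, Matrix.mul_zero]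

/-- The Davis-Kahan sine theorem for the dominant subspace of `A + E`. -/
theorem l2_opNorm_transpose_mul_le_of_dominant {A E : Matrix (Fin n) (Fin n) ℝ}
    {V₁ W : Matrix (Fin n) (Fin r) ℝ} {lam₁ : Fin r → ℝ} {V₂ : Matrix (Fin n) (Fin (n - r)) ℝ}
    {lam₂ : Fin (n - r) → ℝ} (hA : IsEigenDecomp A V₁ lam₁ V₂ lam₂) (hr : r ≤ n)
    {i₀ : Fin r} {j₀ : Fin (n - r)} (hi : ∀ i, lam₁ i₀ ≤ lam₁ i) (hj : ∀ j, lam₂ j ≤ lam₂ j₀)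
    (hW : IsDominantBasis (A + E) W) :
    ∃ M : Matrix (Fin r) (Fin r) ℝ, (A + E) * W = W * M ∧ (lam₁ i₀ - lam₂ j₀ - ‖E‖) * ‖V₂ᵀ * W‖ ≤ ‖E‖ := by
  have hform : ∀ z, (lam₁ i₀ - ‖E‖) * (z ⬝ᵥ z) ≤ (V₁ *ᵥ z) ⬝ᵥ (A + E) *ᵥ (V₁ *ᵥ z) := by
    intro z
    have h1 := le_dotProduct_diagonal_mulVec hi z
    have h2 := (abs_le.1 (dotProduct_mulVec_self_le E (V₁ *ᵥ z))).1
    rw [mulVec_dotProduct_mulVec_of_orthonormal hA.orth₁] at h2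
    have h3 : (V₁ *ᵥ z) ⬝ᵥ A *ᵥ (V₁ *ᵥ z) = z ⬝ᵥ diagonal lam₁ *ᵥ z := by
      rw [mulVec_dotProduct_eq, mulVec_mulVec, mulVec_mulVec, ← hA.blk₁₁, blk]
    rw [add_mulVec, dotProduct_add, h3, sub_mul]
    linarith
  obtain ⟨M, hM, hMform⟩ := hW.exists_mul_eq hr hA.orth₁ hform
  refine ⟨M, hM, ?_⟩
  have hsyl : V₂ᵀ * W * M - diagonal lam₂ * (V₂ᵀ * W) = V₂ᵀ * (E * W) := by
    rw [Matrix.mul_assoc, ← hM, ← Matrix.mul_assoc _ V₂ᵀ, ← hA.transpose_mul_eq, Matrix.add_mul,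
      Matrix.mul_add, Matrix.mul_assoc]
    abel
  have h1 := sylvester_l2_opNorm_ge hMform (dotProduct_diagonal_mulVec_le hj) (V₂ᵀ * W)
  rw [hsyl] at h1
  have h2 : ‖V₂ᵀ * (E * W)‖ ≤ ‖E‖ :=
    (l2_opNorm_mul_left_le
      ((l2_opNorm_transpose V₂).trans_le (l2_opNorm_le_one_of_orthonormal hA.orth₂)) _).trans
      (l2_opNorm_mul_right_le (l2_opNorm_le_one_of_orthonormal hW.1) _)
  linarith

/-- A dominant subspace of a small perturbation of `A` is a graph over the range of `V₁`, whose slope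
`X` satisfies the Riccati equation and has norm at most one. -/
theorem exists_riccati_of_dominant {A E : Matrix (Fin n) (Fin n) ℝ}
    {V₁ W : Matrix (Fin n) (Fin r) ℝ} {lam₁ : Fin r → ℝ} {V₂ : Matrix (Fin n) (Fin (n - r)) ℝ}
    {lam₂ : Fin (n - r) → ℝ} (hA : IsEigenDecomp A V₁ lam₁ V₂ lam₂) (hr : r ≤ n)
    {i₀ : Fin r} {j₀ : Fin (n - r)} (hi : ∀ i, lam₁ i₀ ≤ lam₁ i) (hj : ∀ j, lam₂ j ≤ lam₂ j₀)
    (hlt : lam₂ j₀ < lam₁ i₀) (hE : 5 * ‖E‖ ≤ lam₁ i₀ - lam₂ j₀)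
    (hW : IsDominantBasis (A + E) W) :
    ∃ X : Matrix (Fin (n - r)) (Fin r) ℝ, ‖X‖ ≤ 1 ∧ IsUnit (V₁ᵀ * W) ∧
      W = (V₁ + V₂ * X) * (V₁ᵀ * W) ∧
      X * diagonal lam₁ - diagonal lam₂ * X
        = blk V₂ E V₁ - X * blk V₁ E V₁ + blk V₂ E V₂ * X - X * blk V₁ E V₂ * X := by
  obtain ⟨M, hM, hsin⟩ := l2_opNorm_transpose_mul_le_of_dominant hA hr hi hj hW
  obtain ⟨S, hS⟩ : ∃ S, S = V₂ᵀ * W := ⟨_, rfl⟩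
  obtain ⟨C, hC⟩ : ∃ C, C = V₁ᵀ * W := ⟨_, rfl⟩
  rw [← hS] at hsin
  rw [← hC]
  have hS4 : ‖S‖ ≤ 1 / 4 := by
    have hd := sub_pos.2 hlt
    nlinarith [norm_nonneg S]
  have hWsum : W = V₁ * C + V₂ * S := by
    rw [hC, hS, ← Matrix.mul_assoc, ← Matrix.mul_assoc, ← Matrix.add_mul,
      hA.mul_transpose_add hr, Matrix.one_mul]
  have hCS : Cᵀ * C + Sᵀ * S = 1 := by
    have h1 : Cᵀ * C + Sᵀ * S = Wᵀ * (V₁ * C + V₂ * S) := by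
      rw [Matrix.mul_add, ← Matrix.mul_assoc, ← Matrix.mul_assoc, hC, hS, transpose_mul,
        transpose_mul, transpose_transpose, transpose_transpose]
    rw [h1, ← hWsum, hW.1]
  have hSS : ‖Sᵀ * S‖ ≤ 1 / 16 := by
    rw [l2_opNorm_transpose_mul_self]
    nlinarith [norm_nonneg S]
  have hCu : IsUnit C := by
    have h1 : IsUnit (1 - Sᵀ * S) := by
      have : CompleteSpace (Matrix (Fin r) (Fin r) ℝ) := FiniteDimensional.complete ℝ _
      exact isUnit_one_sub_of_norm_lt_one (hSS.trans_lt (by norm_num))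
    rw [← hCS, add_sub_cancel_right] at h1
    exact isUnit_of_mul_isUnit_right h1
  have hCd : IsUnit C.det := (isUnit_iff_isUnit_det _).1 hCu
  obtain ⟨X, hX⟩ : ∃ X, X = S * C⁻¹ := ⟨_, rfl⟩
  have hXC : X * C = S := by rw [hX, nonsing_inv_mul_cancel_right _ _ hCd]
  -- multiplying `Cᵀ C + Sᵀ S = 1` by `(Cᵀ C)⁻¹` gives `‖C⁻¹‖² ≤ 1 + ‖C⁻¹‖² / 16`
  have hCn : ‖C⁻¹‖ ≤ 2 := by
    have h1 : C⁻¹ * C⁻¹ᵀ = 1 + Sᵀ * S * (C⁻¹ * C⁻¹ᵀ) := by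
      have h2 : (Cᵀ * C) * (C⁻¹ * C⁻¹ᵀ) = 1 := by
        rw [Matrix.mul_assoc, ← Matrix.mul_assoc C, mul_nonsing_inv _ hCd, Matrix.one_mul,
          ← transpose_mul, nonsing_inv_mul _ hCd, transpose_one]
      calc C⁻¹ * C⁻¹ᵀ = (Cᵀ * C + Sᵀ * S) * (C⁻¹ * C⁻¹ᵀ) := by rw [hCS, Matrix.one_mul]
        _ = _ := by rw [Matrix.add_mul, h2]
    have h3 : ‖C⁻¹ * C⁻¹ᵀ‖ = ‖C⁻¹‖ * ‖C⁻¹‖ := by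
      have := l2_opNorm_transpose_mul_self C⁻¹ᵀ
      rwa [transpose_transpose, l2_opNorm_transpose] at this
    have h4 : ‖C⁻¹ * C⁻¹ᵀ‖ ≤ 1 + 1 / 16 * ‖C⁻¹ * C⁻¹ᵀ‖ := by
      conv_lhs => rw [h1]
      refine (norm_add_le _ _).trans (add_le_add l2_opNorm_one_le ((l2_opNorm_mul _ _).trans ?_))
      gcongr
    rw [h3] at h4
    nlinarith [norm_nonneg C⁻¹]
  have hXn : ‖X‖ ≤ 1 := by
    rw [hX]
    calc _ ≤ ‖S‖ * ‖C⁻¹‖ := l2_opNorm_mul _ _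
      _ ≤ 1 / 4 * 2 := by gcongr
      _ ≤ 1 := by norm_num
  have hWX : W = (V₁ + V₂ * X) * C := by
    rw [Matrix.add_mul, Matrix.mul_assoc, hXC, ← hWsum]
  refine ⟨X, hXn, hCu, hWX, ?_⟩
  have hblk : ∀ {k : ℕ} (V : Matrix (Fin n) (Fin k) ℝ),
      (blk V (A + E) V₁ + blk V (A + E) V₂ * X) * C = Vᵀ * W * M := by
    intro k V
    rw [Matrix.mul_assoc Vᵀ, ← hM]
    conv_rhs => rw [hWX]
    simp only [blk, Matrix.add_mul, Matrix.mul_add, Matrix.mul_assoc]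
  have h1 := hblk V₁
  have h2 := hblk V₂
  rw [← hS, ← hXC, Matrix.mul_assoc X, hC, ← h1, ← hC, ← Matrix.mul_assoc] at h2
  have h3 := congrArg (· * C⁻¹) h2
  simp only [mul_nonsing_inv_cancel_right _ _ hCd] at h3
  simp only [blk_add, hA.blk₁₁, hA.blk₁₂, hA.blk₂₁, hA.blk₂₂, Matrix.mul_add, Matrix.add_mul,
    zero_add, ← Matrix.mul_assoc] at h3
  rw [← sub_eq_zero] at h3 ⊢
  rw [← neg_eq_zero, ← h3]
  abel

/-- A root of the Riccati equation in the unit ball has size at most `2 ‖F₂₁‖ / d`. -/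
theorem riccati_norm_le {X : Matrix (Fin p) (Fin q) ℝ} {L₁ F₁₁ : Matrix (Fin q) (Fin q) ℝ}
    {L₂ F₂₂ : Matrix (Fin p) (Fin p) ℝ} {F₂₁ : Matrix (Fin p) (Fin q) ℝ}
    {F₁₂ : Matrix (Fin q) (Fin p) ℝ} {d : ℝ} (hd : 0 < d)
    (hsyl : d * ‖X‖ ≤ ‖X * L₁ - L₂ * X‖)
    (hX : X * L₁ - L₂ * X = F₂₁ - X * F₁₁ + F₂₂ * X - X * F₁₂ * X)
    (h₁₁ : 5 * ‖F₁₁‖ ≤ d) (h₂₂ : 5 * ‖F₂₂‖ ≤ d) (h₂₁ : 5 * ‖F₂₁‖ ≤ d) (h₁₂ : ‖F₁₂‖ = ‖F₂₁‖)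
    (h1 : ‖X‖ ≤ 1) : d * ‖X‖ ≤ 2 * ‖F₂₁‖ := by
  have hle : d * ‖X‖ ≤ ‖F₂₁‖ + ‖X‖ * ‖F₁₁‖ + ‖F₂₂‖ * ‖X‖ + ‖X‖ * ‖F₂₁‖ * ‖X‖ := by
    refine hsyl.trans ?_
    rw [hX]
    refine (norm_sub_le _ _).trans (add_le_add ((norm_add_le _ _).trans (add_le_add
      ((norm_sub_le _ _).trans (add_le_add le_rfl (l2_opNorm_mul _ _))) (l2_opNorm_mul _ _))) ?_)
    rw [← h₁₂]
    refine (l2_opNorm_mul _ _).trans ?_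
    gcongr
    exact l2_opNorm_mul _ _
  have hx := norm_nonneg X
  have he := norm_nonneg F₂₁
  have ha := mul_le_mul_of_nonneg_left h₁₁ hx
  have hb := mul_le_mul_of_nonneg_left h₂₂ hx
  have hc := mul_le_mul_of_nonneg_left h₂₁ hx
  -- the crude bound `‖X‖ ≤ 1` in one factor of the quadratic term gives `‖X‖ ≤ 1 / 2`
  have hhalf : ‖X‖ ≤ 1 / 2 := by
    have h2 : ‖X‖ * ‖F₂₁‖ * ‖X‖ ≤ ‖X‖ * ‖F₂₁‖ := mul_le_of_le_one_right (by positivity) h1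
    refine le_of_mul_le_mul_left ?_ hd
    linarith
  have h2 : ‖X‖ * ‖F₂₁‖ * ‖X‖ ≤ ‖X‖ * ‖F₂₁‖ * (1 / 2) := by gcongr
  linarith

/-- Stability of Riccati roots under a change of the `(2,2)` block alone. -/
theorem riccati_sub_norm_le {X Y : Matrix (Fin p) (Fin q) ℝ} {L₁ F₁₁ : Matrix (Fin q) (Fin q) ℝ}
    {L₂ F₂₂ G₂₂ : Matrix (Fin p) (Fin p) ℝ} {F₂₁ : Matrix (Fin p) (Fin q) ℝ}
    {F₁₂ : Matrix (Fin q) (Fin p) ℝ} {d : ℝ}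
    (hsyl : d * ‖X - Y‖ ≤ ‖(X - Y) * L₁ - L₂ * (X - Y)‖)
    (hX : X * L₁ - L₂ * X = F₂₁ - X * F₁₁ + F₂₂ * X - X * F₁₂ * X)
    (hY : Y * L₁ - L₂ * Y = F₂₁ - Y * F₁₁ + G₂₂ * Y - Y * F₁₂ * Y)
    (h₁₁ : 5 * ‖F₁₁‖ ≤ d) (h₁₂ : 5 * ‖F₁₂‖ ≤ d)
    (hXn : ‖X‖ ≤ 2 / 5) (hYn : ‖Y‖ ≤ 2 / 5) :
    16 * (d * ‖X - Y‖) ≤ 25 * (‖F₂₂‖ * ‖X‖ + ‖G₂₂‖ * ‖Y‖) := by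
  have hsub : (X - Y) * L₁ - L₂ * (X - Y) = F₂₂ * X - G₂₂ * Y - (X - Y) * F₁₁
      - (X - Y) * F₁₂ * X - Y * F₁₂ * (X - Y) := by
    have : (X - Y) * L₁ - L₂ * (X - Y) = (X * L₁ - L₂ * X) - (Y * L₁ - L₂ * Y) := by
      rw [Matrix.sub_mul, Matrix.mul_sub]; abel
    rw [this, hX, hY]
    simp only [Matrix.sub_mul, Matrix.mul_sub]
    abel
  rw [hsub] at hsyl
  have n1 : ‖F₂₂ * X‖ ≤ ‖F₂₂‖ * ‖X‖ := l2_opNorm_mul _ _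
  have n2 : ‖G₂₂ * Y‖ ≤ ‖G₂₂‖ * ‖Y‖ := l2_opNorm_mul _ _
  have n3 : ‖(X - Y) * F₁₁‖ ≤ ‖X - Y‖ * ‖F₁₁‖ := l2_opNorm_mul _ _
  have n4 : ‖(X - Y) * F₁₂ * X‖ ≤ ‖X - Y‖ * ‖F₁₂‖ * (2 / 5) := by
    refine (l2_opNorm_mul _ _).trans ?_
    gcongr
    exact l2_opNorm_mul _ _
  have n5 : ‖Y * F₁₂ * (X - Y)‖ ≤ 2 / 5 * ‖F₁₂‖ * ‖X - Y‖ := by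
    refine (l2_opNorm_mul _ _).trans ?_
    gcongr
    exact (l2_opNorm_mul _ _).trans (by gcongr)
  have t1 := norm_sub_le (F₂₂ * X - G₂₂ * Y - (X - Y) * F₁₁ - (X - Y) * F₁₂ * X)
    (Y * F₁₂ * (X - Y))
  have t2 := norm_sub_le (F₂₂ * X - G₂₂ * Y - (X - Y) * F₁₁) ((X - Y) * F₁₂ * X)
  have t3 := norm_sub_le (F₂₂ * X - G₂₂ * Y) ((X - Y) * F₁₁)
  have t4 := norm_sub_le (F₂₂ * X) (G₂₂ * Y)
  have ha := mul_le_mul_of_nonneg_left h₁₁ (norm_nonneg (X - Y))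
  have hb := mul_le_mul_of_nonneg_left h₁₂ (norm_nonneg (X - Y))
  linarith

/-- The Riccati equation read row by row: the terms `X F₁₁` and `X F₁₂ X` are absorbed on the left.
The factor `18 / 25` is `1 - 1 / 5 - (1 / 5) (2 / 5)`. -/
theorem riccati_norm2Inf_le {V : Matrix (Fin n) (Fin p) ℝ} {X : Matrix (Fin p) (Fin q) ℝ}
    {L₁ F₁₁ : Matrix (Fin q) (Fin q) ℝ} {L₂ F₂₂ : Matrix (Fin p) (Fin p) ℝ}
    {F₂₁ : Matrix (Fin p) (Fin q) ℝ} {F₁₂ : Matrix (Fin q) (Fin p) ℝ} {g : ℝ}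
    (hsyl : g * norm2Inf (V * X) ≤ norm2Inf (V * (X * L₁ - L₂ * X)))
    (hX : X * L₁ - L₂ * X = F₂₁ - X * F₁₁ + F₂₂ * X - X * F₁₂ * X)
    (h₁₁ : 5 * ‖F₁₁‖ ≤ g) (h₁₂ : 5 * ‖F₁₂‖ ≤ g) (hXn : ‖X‖ ≤ 2 / 5) :
    18 * (g * norm2Inf (V * X)) ≤ 25 * (norm2Inf (V * F₂₁) + norm2Inf (V * (F₂₂ * X))) := by
  have hsplit : V * (X * L₁ - L₂ * X)
      = V * F₂₁ - V * X * F₁₁ + V * (F₂₂ * X) - V * X * (F₁₂ * X) := by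
    rw [hX]
    simp only [Matrix.mul_sub, Matrix.mul_add, Matrix.mul_assoc]
  rw [hsplit] at hsyl
  have h0 := norm2Inf_nonneg (V * X)
  have n1 := norm2Inf_mul_le (V * X) F₁₁
  have n2 : norm2Inf (V * X * (F₁₂ * X)) ≤ norm2Inf (V * X) * (‖F₁₂‖ * (2 / 5)) := by
    refine (norm2Inf_mul_le _ _).trans ?_
    gcongr
    exact (l2_opNorm_mul _ _).trans (by gcongr)
  have t1 := norm2Inf_sub_le (V * F₂₁ - V * X * F₁₁ + V * (F₂₂ * X)) (V * X * (F₁₂ * X))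
  have t2 := norm2Inf_add_le (V * F₂₁ - V * X * F₁₁) (V * (F₂₂ * X))
  have t3 := norm2Inf_sub_le (V * F₂₁) (V * X * F₁₁)
  have ha := mul_le_mul_of_nonneg_left h₁₁ h0
  have hb := mul_le_mul_of_nonneg_left h₁₂ h0
  linarith

/-! ### The aligned basis -/

/-- For the basis `W` of the graph of `X`, aligned with `V₁` by a Procrustes solution `U`, one has
`W U = (V₁ + V₂ X) H` with `H = V₁ᵀ W U` positive definite, `‖H‖ ≤ 1` and `H (1 + Xᵀ X) H = 1`. -/
theorem procrustes_norm2Inf_le {V₁ W : Matrix (Fin n) (Fin r) ℝ} {V₂ : Matrix (Fin n) (Fin p) ℝ}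
    {U : Matrix (Fin r) (Fin r) ℝ} {X : Matrix (Fin p) (Fin r) ℝ} (hV₁ : V₁ᵀ * V₁ = 1)
    (hV₂ : V₂ᵀ * V₂ = 1) (hV₁₂ : V₁ᵀ * V₂ = 0) (hW : Wᵀ * W = 1) (hU : IsProcrustes W V₁ U)
    (hu : IsUnit (V₁ᵀ * W)) (hWX : W = (V₁ + V₂ * X) * (V₁ᵀ * W)) :
    norm2Inf (W * U - V₁) ≤ norm2Inf V₁ * ‖X‖ ^ 2 + norm2Inf (V₂ * X) := by
  have hpos := hU.posDef hW hu
  have hUU : Uᵀ * U = 1 := (mem_orthogonalGroup_iff' (Fin r) ℝ).1 hU.1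
  obtain ⟨H, hH⟩ : ∃ H, H = V₁ᵀ * W * U := ⟨_, rfl⟩
  rw [← hH] at hpos
  have hHs : Hᵀ = H := by
    have := hpos.isHermitian.eq
    rwa [conjTranspose_eq_transpose_of_trivial] at this
  have hWU : W * U = (V₁ + V₂ * X) * H := by
    rw [hH, ← Matrix.mul_assoc, ← hWX]
  have hWUo : (W * U)ᵀ * (W * U) = 1 := by
    rw [transpose_mul, Matrix.mul_assoc, ← Matrix.mul_assoc Wᵀ, hW, Matrix.one_mul, hUU]
  have hV₂₁ : V₂ᵀ * V₁ = 0 := by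
    have := congrArg transpose hV₁₂
    rwa [transpose_mul, transpose_transpose, transpose_zero] at this
  have hgram : (V₁ + V₂ * X)ᵀ * (V₁ + V₂ * X) = 1 + Xᵀ * X := by
    rw [transpose_add, transpose_mul, Matrix.add_mul, Matrix.mul_add, Matrix.mul_add, hV₁,
      ← Matrix.mul_assoc V₁ᵀ, hV₁₂, Matrix.mul_assoc Xᵀ, hV₂₁, Matrix.mul_assoc Xᵀ,
      ← Matrix.mul_assoc V₂ᵀ, hV₂]
    simp
  have hHGH : H * ((1 + Xᵀ * X) * H) = 1 := by
    rw [← hgram]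
    rw [hWU, transpose_mul, hHs] at hWUo
    rw [← hWUo]
    simp only [Matrix.mul_assoc]
  have hHn : ‖H‖ ≤ 1 := by
    rw [hH, Matrix.mul_assoc]
    exact (l2_opNorm_mul_left_le
      ((l2_opNorm_transpose V₁).trans_le (l2_opNorm_le_one_of_orthonormal hV₁)) _).trans
      (l2_opNorm_le_one_of_orthonormal hWUo)
  have hsq : (1 + H) * (1 - H) = Xᵀ * X * (H * H) := by
    have h1 : (1 + Xᵀ * X) * H * H = 1 := mul_eq_one_comm.1 hHGH
    rw [Matrix.add_mul, Matrix.add_mul, Matrix.one_mul] at h1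
    rw [← Matrix.mul_assoc, ← sub_eq_zero]
    have h2 : (1 + H) * (1 - H) = 1 - H * H := by
      rw [Matrix.add_mul, Matrix.mul_sub, Matrix.mul_sub]; simp
    rw [h2, ← h1]
    abel
  have hHH : ‖Xᵀ * X * (H * H)‖ ≤ ‖X‖ ^ 2 := by
    refine (l2_opNorm_mul_right_le ((l2_opNorm_mul_left_le hHn H).trans hHn) _).trans ?_
    rw [l2_opNorm_transpose_mul_self, sq]
  -- `(1 + H) (1 - H) = Xᵀ X H²`, and `1 + H` does not shrink vectors since `H ≥ 0`
  have h1H : ‖1 - H‖ ≤ ‖X‖ ^ 2 := by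
    refine l2_opNorm_le_of_forall (sq_nonneg _) fun v => ?_
    obtain ⟨w, hw⟩ : ∃ w, w = (1 - H) *ᵥ v := ⟨_, rfl⟩
    rw [← hw]
    have e1 : (1 + H) *ᵥ w = (Xᵀ * X * (H * H)) *ᵥ v := by rw [hw, mulVec_mulVec, hsq]
    have e2 : ‖toLp 2 ((1 + H) *ᵥ w)‖ ≤ ‖X‖ ^ 2 * ‖toLp 2 v‖ := by
      rw [e1]
      have : ‖toLp 2 ((Xᵀ * X * (H * H)) *ᵥ v)‖ ≤ ‖Xᵀ * X * (H * H)‖ * ‖toLp 2 v‖ :=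
        l2_opNorm_mulVec _ (toLp 2 v)
      exact this.trans (by gcongr)
    have e3 := dotProduct_le_norm_mul w ((1 + H) *ᵥ w)
    have e4 : 0 ≤ w ⬝ᵥ H *ᵥ w := by simpa using hpos.posSemidef.dotProduct_mulVec_nonneg w
    rw [add_mulVec, one_mulVec, dotProduct_add, ← norm_toLp_sq] at e3
    rw [add_mulVec, one_mulVec] at e2
    refine le_trans ?_ e2
    rcases (norm_nonneg (toLp 2 w)).eq_or_lt with h0 | h0
    · rw [← h0]; exact norm_nonneg _
    · refine le_of_mul_le_mul_left ?_ h0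
      nlinarith
  have hfin : W * U - V₁ = V₂ * X * H - V₁ * (1 - H) := by
    rw [hWU, Matrix.add_mul, Matrix.mul_sub, Matrix.mul_one]; abel
  rw [hfin]
  refine (norm2Inf_sub_le _ _).trans ?_
  have b1 := norm2Inf_mul_le (V₂ * X) H
  have b2 := norm2Inf_mul_le V₁ (1 - H)
  have b3 := mul_le_of_le_one_right (norm2Inf_nonneg (V₂ * X)) hHn
  have b4 := mul_le_mul_of_nonneg_left h1H (norm2Inf_nonneg V₁)
  linarith

end RowPerturb

end

open RowPerturb Matrix in
open scoped Matrix.Norms.L2Operator in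
theorem lemmaC1 {n r : ℕ} (hr : 1 ≤ r) (hrn : r < n)
    (A : Matrix (Fin n) (Fin n) ℝ)
    (V₁ : Matrix (Fin n) (Fin r) ℝ) (lam₁ : Fin r → ℝ)
    (V₂ : Matrix (Fin n) (Fin (n - r)) ℝ) (lam₂ : Fin (n - r) → ℝ)
    (hA : IsEigenDecomp A V₁ lam₁ V₂ lam₂)
    (hsplit : ∀ i j, lam₂ j < lam₁ i)
    (E Et : Matrix (Fin n) (Fin n) ℝ) (hE : E.IsSymm) (hEt : Et.IsSymm)
    (h12 : blk V₁ E V₂ = blk V₁ Et V₂) (h11 : blk V₁ E V₁ = blk V₁ Et V₁)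
    (hEgap : norm2 E ≤ gap lam₁ V₂ lam₂ / 5)
    (hEtgap : norm2 Et ≤ gap lam₁ V₂ lam₂ / 5) :
    -- a root in the range of V₂ within the stated norm bound exists
    (∃ Yt : Matrix (Fin n) (Fin r) ℝ, InRan V₂ Yt ∧ quadG V₁ V₂ (A + Et) Yt = 0 ∧
      norm2 Yt ≤ 4 * norm2 (blk V₂ E V₁) / sep norm2 (diagonal lam₁) (diagonal lam₂)) ∧
    -- and the perturbation bound holds with every such root
    (∀ Yt : Matrix (Fin n) (Fin r) ℝ, InRan V₂ Yt → quadG V₁ V₂ (A + Et) Yt = 0 →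
      norm2 Yt ≤ 4 * norm2 (blk V₂ E V₁) / sep norm2 (diagonal lam₁) (diagonal lam₂) →
      ∀ Vh₁ : Matrix (Fin n) (Fin r) ℝ, IsDominantBasis (A + E) Vh₁ →
      ∀ U : Matrix (Fin r) (Fin r) ℝ, IsProcrustes Vh₁ V₁ U →
      norm2Inf (Vh₁ * U - V₁) ≤
        8 * norm2Inf V₁ *
            (norm2 (blk V₂ E V₁) / sep norm2 (diagonal lam₁) (diagonal lam₂)) ^ 2
        + 2 * (norm2Inf (V₂ * blk V₂ E V₁) / gap lam₁ V₂ lam₂)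
        + 4 * (norm2Inf (V₂ * blk V₂ E V₂ * V₂ᵀ * Yt) / gap lam₁ V₂ lam₂)
        + 5 * ((norm2 (blk V₂ E V₂) + norm2 (blk V₂ Et V₂))
              * norm2Inf (V₂ * blk V₂ E V₂ * V₂ᵀ) * norm2 (blk V₂ E V₁)
            / (gap lam₁ V₂ lam₂ * sep norm2 (diagonal lam₁) (diagonal lam₂) ^ 2))
        + 10 * (norm2Inf (V₂ * blk V₂ E V₂ * V₂ᵀ) * norm2 (blk V₂ E V₁) ^ 3
            / (gap lam₁ V₂ lam₂ * sep norm2 (diagonal lam₁) (diagonal lam₂) ^ 3))) := by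
  have : NeZero r := ⟨by omega⟩
  have : NeZero (n - r) := ⟨by omega⟩
  obtain ⟨i₀, hi⟩ := Finite.exists_min lam₁
  obtain ⟨j₀, hj⟩ := Finite.exists_max lam₂
  have hlt := hsplit i₀ j₀
  have hsep : sep norm2 (diagonal lam₁) (diagonal lam₂) = lam₁ i₀ - lam₂ j₀ :=
    sep_diagonal hi hj hlt.le
  have hgap : 0 < gap lam₁ V₂ lam₂ := gap_pos hA.orth₂ hi hj hlt
  have hgd : gap lam₁ V₂ lam₂ ≤ lam₁ i₀ - lam₂ j₀ := hsep ▸ min_le_left _ _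
  have hgo : gap lam₁ V₂ lam₂
      ≤ sepOn norm2Inf V₂ (diagonal lam₁) (V₂ * diagonal lam₂ * V₂ᵀ) := min_le_right _ _
  have h21 : blk V₂ E V₁ = blk V₂ Et V₁ := by
    rw [← transpose_blk V₁ hE V₂, ← transpose_blk V₁ hEt V₂, h12]
  rw [hsep]
  obtain ⟨d, hd⟩ : ∃ d, d = lam₁ i₀ - lam₂ j₀ := ⟨_, rfl⟩
  obtain ⟨g, hg⟩ : ∃ g, g = gap lam₁ V₂ lam₂ := ⟨_, rfl⟩
  rw [← hg] at hEgap hEtgap hgap hgd hgo ⊢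
  rw [← hd] at hgd ⊢
  have hd0 : 0 < d := hgap.trans_le hgd
  rw [norm2_eq_l2_opNorm] at hEgap hEtgap
  have hEd : 5 * ‖E‖ ≤ d := by linarith
  have hEtd : 5 * ‖Et‖ ≤ d := by linarith
  have hsyl : ∀ Z : Matrix (Fin (n - r)) (Fin r) ℝ,
      d * ‖Z‖ ≤ ‖Z * diagonal lam₁ - diagonal lam₂ * Z‖ := fun Z => hd ▸
    sylvester_l2_opNorm_ge (le_dotProduct_diagonal_mulVec hi)
      (dotProduct_diagonal_mulVec_le hj) Z
  -- roots in the unit ball obey the sharper bound `‖X‖ ≤ 2 ‖E₂₁‖ / sep`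
  have hroot : ∀ {F : Matrix (Fin n) (Fin n) ℝ}, F.IsSymm → 5 * ‖F‖ ≤ d →
      ∀ {X : Matrix (Fin (n - r)) (Fin r) ℝ}, X * diagonal lam₁ - diagonal lam₂ * X
        = blk V₂ F V₁ - X * blk V₁ F V₁ + blk V₂ F V₂ * X - X * blk V₁ F V₂ * X →
      ‖X‖ ≤ 1 → d * ‖X‖ ≤ 2 * ‖blk V₂ F V₁‖ := by
    intro F hF hFd X hX h1
    have b11 := l2_opNorm_blk_le hA.orth₁ F hA.orth₁
    have b22 := l2_opNorm_blk_le hA.orth₂ F hA.orth₂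
    have b21 := l2_opNorm_blk_le hA.orth₂ F hA.orth₁
    exact riccati_norm_le hd0 (hsyl X) hX (by linarith) (by linarith) (by linarith)
      (by rw [← transpose_blk V₂ hF V₁, l2_opNorm_transpose]) h1
  have he := norm_nonneg (blk V₂ E V₁)
  have he5 : 5 * ‖blk V₂ E V₁‖ ≤ d := by
    linarith [l2_opNorm_blk_le hA.orth₂ E hA.orth₁]
  simp only [norm2_eq_l2_opNorm]
  refine ⟨?_, ?_⟩
  · obtain ⟨W, hW⟩ := exists_isDominantBasis (hA.isSymm.add hEt) hrn.le
    obtain ⟨X, hX1, -, -, hX⟩ :=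
      exists_riccati_of_dominant hA hrn.le hi hj hlt (hd ▸ hEtd) hW
    refine ⟨V₂ * X, ⟨X, rfl⟩, ?_, ?_⟩
    · rw [quadG_mul_eq hA, hX, sub_self, Matrix.mul_zero]
    · have := hroot hEt hEtd hX hX1
      rw [l2_opNorm_mul_of_orthonormal hA.orth₂, le_div_iff₀ hd0, h21, mul_comm]
      linarith [norm_nonneg (blk V₂ Et V₁)]
  · rintro _ ⟨Xt, rfl⟩ hquad hYn W hW U hU
    obtain ⟨X, hX1, hu, hWX, hX⟩ :=
      exists_riccati_of_dominant hA hrn.le hi hj hlt (hd ▸ hEd) hW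
    have hXt := sub_eq_zero.1
      (eq_zero_of_orthonormal_mul_eq_zero hA.orth₂ ((quadG_mul_eq hA Et Xt).symm.trans hquad))
    have hXn := hroot hE hEd hX hX1
    have hXt1 : ‖Xt‖ ≤ 1 := by
      rw [l2_opNorm_mul_of_orthonormal hA.orth₂, le_div_iff₀ hd0] at hYn
      refine le_of_mul_le_mul_right ?_ hd0
      linarith
    have hXtn := hroot hEt hEtd hXt hXt1
    rw [← h21] at hXtn
    rw [← h21, ← h11, ← h12] at hXt
    have hX25 : ‖X‖ ≤ 2 / 5 := le_of_mul_le_mul_left (by linarith) hd0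
    have hXt25 : ‖Xt‖ ≤ 2 / 5 := le_of_mul_le_mul_left (by linarith) hd0
    have b11 := l2_opNorm_blk_le hA.orth₁ E hA.orth₁
    have b12 := l2_opNorm_blk_le hA.orth₁ E hA.orth₂
    have hdiff := riccati_sub_norm_le (hsyl _) hX hXt (by linarith) (by linarith) hX25 hXt25
    have hproc := procrustes_norm2Inf_le hA.orth₁ hA.orth₂ hA.orth₁₂ hW.1 hU hu hWX
    have hrow := riccati_norm2Inf_le (V := V₂) (g := g)
      (by
        refine (mul_le_mul_of_nonneg_right hgo (norm2Inf_nonneg _)).trans ?_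
        refine (sepOn_mul_norm2Inf_le ⟨X, rfl⟩ _ _).trans_eq (congrArg _ ?_)
        rw [Matrix.mul_sub, Matrix.mul_assoc _ V₂ᵀ, ← Matrix.mul_assoc V₂ᵀ, hA.orth₂,
          Matrix.one_mul]
        simp only [Matrix.mul_assoc])
      hX (by linarith) (by linarith) hX25
    have hsplitY : norm2Inf (V₂ * (blk V₂ E V₂ * X))
        ≤ norm2Inf (V₂ * blk V₂ E V₂ * V₂ᵀ * (V₂ * Xt))
          + norm2Inf (V₂ * blk V₂ E V₂ * V₂ᵀ) * ‖X - Xt‖ := by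
      have h1 : ∀ Z : Matrix (Fin (n - r)) (Fin r) ℝ,
          V₂ * blk V₂ E V₂ * V₂ᵀ * (V₂ * Z) = V₂ * (blk V₂ E V₂ * Z) := fun Z => by
        rw [Matrix.mul_assoc _ V₂ᵀ, ← Matrix.mul_assoc V₂ᵀ, hA.orth₂, Matrix.one_mul,
          Matrix.mul_assoc]
      have h2 := norm2Inf_mul_le (V₂ * blk V₂ E V₂ * V₂ᵀ) (V₂ * (X - Xt))
      rw [l2_opNorm_mul_of_orthonormal hA.orth₂] at h2
      refine le_trans ?_ (add_le_add le_rfl h2)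
      rw [← h1, ← add_sub_cancel Xt X, Matrix.mul_add, Matrix.mul_add, add_sub_cancel]
      exact norm2Inf_add_le _ _
    -- from here on only real numbers are involved
    have hv := norm2Inf_nonneg V₁
    have ha := norm2Inf_nonneg (V₂ * blk V₂ E V₁)
    have hb := norm2Inf_nonneg (V₂ * blk V₂ E V₂ * V₂ᵀ * (V₂ * Xt))
    have hN := norm2Inf_nonneg (V₂ * blk V₂ E V₂ * V₂ᵀ)
    have hf := norm_nonneg (blk V₂ E V₂)
    have hft := norm_nonneg (blk V₂ Et V₂)
    have hx := norm_nonneg X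
    generalize norm2Inf V₁ = v at *
    generalize norm2Inf (V₂ * blk V₂ E V₁) = a at *
    generalize norm2Inf (V₂ * blk V₂ E V₂ * V₂ᵀ * (V₂ * Xt)) = b at *
    generalize norm2Inf (V₂ * blk V₂ E V₂ * V₂ᵀ) = N at *
    generalize norm2Inf (V₂ * (blk V₂ E V₂ * X)) = y at *
    generalize norm2Inf (V₂ * X) = P at *
    generalize ‖blk V₂ E V₁‖ = e at *
    generalize ‖blk V₂ E V₂‖ = f at *
    generalize ‖blk V₂ Et V₂‖ = f' at *
    generalize ‖X - Xt‖ = D at *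
    generalize ‖X‖ = x at *
    generalize ‖Xt‖ = x' at *
    have hxd : x ^ 2 ≤ 4 * (e / d) ^ 2 := by
      have h1 : x ≤ 2 * (e / d) := by
        rw [← mul_div_assoc, le_div_iff₀ hd0]; linarith
      calc x ^ 2 ≤ (2 * (e / d)) ^ 2 := by gcongr
        _ = _ := by ring
    -- the coefficient `25 / 18 * (25 / 8)` that results for `N * D` is below `5`
    have hD : D ≤ 25 / 8 * ((f + f') * e / d ^ 2) := by
      rw [← mul_div_assoc, le_div_iff₀ (by positivity)]
      have h1 := mul_le_mul_of_nonneg_left hXn hf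
      have h2 := mul_le_mul_of_nonneg_left hXtn hft
      have h3 := mul_le_mul_of_nonneg_left hdiff hd0.le
      nlinarith
    have hP : P ≤ 25 / 18 * (a / g) + 25 / 18 * (b / g)
        + 25 / 18 * (25 / 8 * ((f + f') * N * e / (g * d ^ 2))) := by
      have h1 : P ≤ 25 / 18 * ((a + b + N * D) / g) := by
        rw [← mul_div_assoc, le_div_iff₀ hgap]; linarith
      have h2 : N * D / g ≤ N * (25 / 8 * ((f + f') * e / d ^ 2)) / g := by gcongr
      have h3 : N * (25 / 8 * ((f + f') * e / d ^ 2)) / g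
          = 25 / 8 * ((f + f') * N * e / (g * d ^ 2)) := by
        field_simp
      rw [h3] at h2
      rw [add_div, add_div] at h1
      linarith
    have p1 : 0 ≤ a / g := by positivity
    have p2 : 0 ≤ b / g := by positivity
    have p3 : 0 ≤ (f + f') * N * e / (g * d ^ 2) := by positivity
    have p4 : 0 ≤ N * e ^ 3 / (g * d ^ 3) := by positivity
    have p5 : v * x ^ 2 ≤ v * (4 * (e / d) ^ 2) := by gcongr
    have p6 : 0 ≤ v * (e / d) ^ 2 := by positivity
    linarith
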